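/- For $k\ge 0$ let $\pi_k$ be the $(k+1)$-dimensional irreducible unitary representation of $SU(2)$ on $H_k=\mathbb{C}^{k+1}$ (the $k$-th symmetric power of the defining representation, in its canonical orthonormal basis). For $m\in\{l-1,l+1\}$ let $\alpha_m : H_l\to H_1\otimes H_m$ be an isometry with $(\pi_1(x)\otimes\pi_m(x))\,\alpha_m=\alpha_m\,\pi_l(x)$ for all $x\in SU(2)$, and let $\Phi^{l\to 1}_m(X)=(\mathrm{id}\otimes\mathrm{Tr})(\alpha_m X\alpha_m^*)$, $X\in B(H_l)$, be the corresponding $SU(2)$-Clebsch-Gordan channel. For a linear map $\Phi:B(H_A)\to B(H_B)$ with $d_A=\dim H_A$ let $C_\Phi=\sum_{i,j}|i\rangle\langle j|\otimes\Phi(|i\rangle\langle j|)$. Call $\Phi$ PPT if $(\mathrm{id}\otimes T_B)(C_\Phi)$ is positive semidefinite, where $T_B$ is the transpose on $B(H_B)$, and entanglement-breaking (EBT) if $\frac{1}{d_A}C_\Phi=\sum_i q_i\,\rho_i\otimes\sigma_i$ for a finite probability distribution $(q_i)$ and quantum states $\rho_i$ on $H_A$, $\sigma_i$ on $H_B$.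 **Theorem 3.2.** Let $l\ge 1$ be an integer and $0\le p\le 1$. Isometries $\alpha_{l-1}$ and $\alpha_{l+1}$ as above exist, and for any choice of them the channel $$\Psi_p=(1-p)\,\Phi^{l\to 1}_{l-1}+p\,\Phi^{l\to 1}_{l+1}$$ satisfies $$\Psi_p\text{ is PPT}\iff \frac{1}{l+1}\le p\le 1\iff \Psi_p\text{ is EBT}.$$ -/

import Mathlib

open scoped Kronecker ComplexOrder

noncomputable section

/-- The irreducible unitary representation `π_k` of `SU(2)` on `H_k = ℂ^(k+1)`, as the `k`-th
symmetric power of the defining representation. The canonical orthonormal basis vector `|j⟩` is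
`√(k choose j) · u^(k-j) v^j`, where `u, v` is the standard basis of `ℂ²`, and `g` sends
`u ↦ g₀₀ u + g₁₀ v` and `v ↦ g₀₁ u + g₁₁ v`. The entry `⟨i| π_k(g) |j⟩` is therefore
`√(k choose j) / √(k choose i)` times the coefficient of `u^(k-i) v^i` in
`(g₀₀ u + g₁₀ v)^(k-j) (g₀₁ u + g₁₁ v)^j`; below, `u` is set to `1` and `v` is the variable. -/
def spinRep (k : ℕ) (g : Matrix.specialUnitaryGroup (Fin 2) ℂ) :
    Matrix (Fin (k + 1)) (Fin (k + 1)) ℂ :=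
  Matrix.of fun i j =>
    ((Real.sqrt (k.choose j) / Real.sqrt (k.choose i) : ℝ) : ℂ) *
      ((Polynomial.C (g.1 0 0) + Polynomial.C (g.1 1 0) * Polynomial.X) ^ (k - (j : ℕ)) *
        (Polynomial.C (g.1 0 1) + Polynomial.C (g.1 1 1) * Polynomial.X) ^ (j : ℕ)).coeff (i : ℕ)

/-- `α` is an isometry `H_k → H_l ⊗ H_m` that intertwines `π_k` with `π_l ⊗ π_m`
(a Clebsch-Gordan isometry `α^{l,m}_k`; it is unique up to a phase). -/
structure IsClebschGordanIsometry (l m k : ℕ)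
    (α : Matrix (Fin (l + 1) × Fin (m + 1)) (Fin (k + 1)) ℂ) : Prop where
  isometry : α.conjTranspose * α = 1
  intertwines : ∀ g : Matrix.specialUnitaryGroup (Fin 2) ℂ,
    (spinRep l g ⊗ₖ spinRep m g) * α = α * spinRep k g

/-- The map `id ⊗ Tr : B(H_B ⊗ H_E) → B(H_B)`. -/
def partialTraceRight {B E : Type*} [Fintype E] :
    Matrix (B × E) (B × E) ℂ →ₗ[ℂ] Matrix B B ℂ where
  toFun M := Matrix.of fun b b' => ∑ e, M (b, e) (b', e)
  map_add' M N := by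
    ext b b'
    simp [Finset.sum_add_distrib]
  map_smul' c M := by
    ext b b'
    simp [Finset.mul_sum]

/-- The map `X ↦ (id ⊗ Tr)(α X α*)` with Stinespring operator `α : H_A → H_B ⊗ H_E`. -/
def stinespringMap {A B E : Type*} [Fintype A] [Fintype E] (α : Matrix (B × E) A ℂ) :
    Matrix A A ℂ →ₗ[ℂ] Matrix B B ℂ where
  toFun X := partialTraceRight (α * X * α.conjTranspose)
  map_add' X Y := by
    rw [Matrix.mul_add, Matrix.add_mul, map_add]
  map_smul' c X := by
    rw [Matrix.mul_smul, Matrix.smul_mul, map_smul, RingHom.id_apply]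

/-- The Choi matrix `C_Φ = ∑ᵢⱼ |i⟩⟨j| ⊗ Φ(|i⟩⟨j|)`. -/
def choiMatrix {A B : Type*} [Fintype A] [DecidableEq A]
    (Φ : Matrix A A ℂ →ₗ[ℂ] Matrix B B ℂ) : Matrix (A × B) (A × B) ℂ :=
  ∑ i, ∑ j, Matrix.single i j (1 : ℂ) ⊗ₖ Φ (Matrix.single i j 1)

/-- The partial transpose `id ⊗ T_B` on `B(H_A ⊗ H_B)`. -/
def partialTranspose {A B : Type*} (M : Matrix (A × B) (A × B) ℂ) :
    Matrix (A × B) (A × B) ℂ :=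
  Matrix.of fun x y => M (x.1, y.2) (y.1, x.2)

/-- `Φ` is PPT: the partial transpose of its Choi matrix is positive semidefinite. -/
def IsPPT {A B : Type*} [Fintype A] [DecidableEq A]
    (Φ : Matrix A A ℂ →ₗ[ℂ] Matrix B B ℂ) : Prop :=
  (partialTranspose (choiMatrix Φ)).PosSemidef

/-- A quantum state (density matrix). -/
def IsQuantumState {A : Type*} [Fintype A] (ρ : Matrix A A ℂ) : Prop :=
  ρ.PosSemidef ∧ ρ.trace = 1

/-- `M` is separable: a finite convex combination of product states. -/
def IsSeparableState {A B : Type*} [Fintype A] [Fintype B]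
    (M : Matrix (A × B) (A × B) ℂ) : Prop :=
  ∃ (n : ℕ) (q : Fin n → ℝ) (ρ : Fin n → Matrix A A ℂ) (σ : Fin n → Matrix B B ℂ),
    (∀ i, 0 ≤ q i) ∧ ∑ i, q i = 1 ∧
    (∀ i, IsQuantumState (ρ i)) ∧ (∀ i, IsQuantumState (σ i)) ∧
    M = ∑ i, (q i : ℂ) • (ρ i ⊗ₖ σ i)

/-- `Φ` is entanglement-breaking (EBT): its normalized Choi matrix `C_Φ / d_A` is separable. -/
def IsEBT {A B : Type*} [Fintype A] [DecidableEq A] [Fintype B]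
    (Φ : Matrix A A ℂ →ₗ[ℂ] Matrix B B ℂ) : Prop :=
  IsSeparableState ((Fintype.card A : ℂ)⁻¹ • choiMatrix Φ)

end

/-!
The channel `Ψ_p` is `SU(2)`-covariant, so its Choi matrix lies in a two-dimensional space of
explicit band matrices `covariantMatrix l x y`; everything reduces to the two numbers `x` and `y`.

*Clebsch-Gordan isometries.* On binary forms they are the polarization
`f ↦ (u ⊗ ∂f/∂u + v ⊗ ∂f/∂v) / l` and a multiple of `f ↦ u ⊗ v f - v ⊗ u f`
(`isClebschGordanIsometry_polarization`, `isClebschGordanIsometry_wedgeEmbedding`); intertwining is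
the chain rule, respectively `det g = 1`, read off coefficientwise. They are unique up to a phase,
which the channel does not see: the torus forces an intertwiner to preserve weights
(`Intertwines.weight_eq`), an intertwiner that kills the highest weight vector then vanishes
(`Intertwines.eq_zero`), and the image of the highest weight vector is determined up to a scalar.

*PPT implies `1 / (l + 1) ≤ p`.* The partial transpose of the Choi matrix has the eigenvalue
`p - (1 - p) / l` on the summand of lower spin; it is tested on the highest weight vector of that
summand (`le_of_posSemidef_partialTranspose`).

*`1 / (l + 1) ≤ p` implies EBT.* For such `p` the channel measures in the spin coherent states
`ψ^l` and prepares a mixture of `ψ*` and its orthogonal complement, with weight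
`τ = ((l + 1) p - 1) / l` on the complement. The invariant average over `ψ` is replaced by a finite
one: roots of unity for the phase, and for the modulus a quadrature formula with positive weights
(`exists_quadrature`), which exists because the integral of the moment curve lies in its convex
hull. See `covariantMatrix_eq_sum_coherent`. That EBT implies PPT is the Peres criterion
(`IsEBT.isPPT`), which closes the circle.
-/

noncomputable section

/-! ### Binary forms and the explicit Clebsch-Gordan isometries -/

/-- The square root of the binomial coefficient `k choose j`, as a complex number: the norm
factor of the canonical basis vector `√(k choose j) u^(k-j) v^j` of `H_k`. -/
def binomRoot (k j : ℕ) : ℂ := ((Real.sqrt (k.choose j) : ℝ) : ℂ)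

/-- The coefficient of `u^(k-i) v^i` in `(g₀₀ u + g₁₀ v)^(k-j) (g₀₁ u + g₁₁ v)^j`: the matrix
of the `k`-th symmetric power of `g` in the monomial (non-normalized) basis. -/
def symPowCoeff (k : ℕ) (g : Matrix (Fin 2) (Fin 2) ℂ) (i j : ℕ) : ℂ :=
  ((Polynomial.C (g 0 0) + Polynomial.C (g 1 0) * Polynomial.X) ^ (k - j) *
    (Polynomial.C (g 0 1) + Polynomial.C (g 1 1) * Polynomial.X) ^ j).coeff i

theorem natCast_choose_ne_zero {n j : ℕ} (h : j ≤ n) : (n.choose j : ℂ) ≠ 0 := by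
  exact_mod_cast (Nat.choose_pos h).ne'

theorem binomRoot_sq (k j : ℕ) : binomRoot k j ^ 2 = (k.choose j : ℂ) := by
  rw [binomRoot, ← Complex.ofReal_pow, Real.sq_sqrt (Nat.cast_nonneg _), Complex.ofReal_natCast]

theorem binomRoot_mul_self (k j : ℕ) : binomRoot k j * binomRoot k j = (k.choose j : ℂ) := by
  rw [← sq, binomRoot_sq]

theorem binomRoot_ne_zero {k j : ℕ} (h : j ≤ k) : binomRoot k j ≠ 0 := by
  intro h0
  have := binomRoot_sq k j
  rw [h0] at this
  have h1 : (k.choose j : ℂ) ≠ 0 := by exact_mod_cast (Nat.choose_pos h).ne'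
  exact h1 (by simpa using this.symm)

theorem binomRoot_zero_right (k : ℕ) : binomRoot k 0 = 1 := by simp [binomRoot]

theorem star_binomRoot (k j : ℕ) : star (binomRoot k j) = binomRoot k j := by
  simp [binomRoot]

theorem spinRep_apply (k : ℕ) (g : Matrix.specialUnitaryGroup (Fin 2) ℂ) (i j : Fin (k + 1)) :
    spinRep k g i j = binomRoot k j / binomRoot k i * symPowCoeff k g.1 i j := by
  simp [spinRep, binomRoot, symPowCoeff]

theorem spinRep_one_apply (g : Matrix.specialUnitaryGroup (Fin 2) ℂ) (i j : Fin 2) :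
    spinRep 1 g i j = g.1 i j := by
  rw [spinRep_apply]
  fin_cases i <;> fin_cases j <;>
    simp [binomRoot, symPowCoeff, Polynomial.coeff_C]

theorem sum_fin_ite_add_eq (N b j : ℕ) (F : ℕ → ℂ) :
    ∑ e : Fin N, (if b + (e : ℕ) = j then F e else 0) =
      if b ≤ j ∧ j < b + N then F (j - b) else 0 := by
  split_ifs with h
  · rw [Finset.sum_eq_single ⟨j - b, by omega⟩]
    · simp [h.1]
    · intro e _ he
      rw [if_neg]
      intro h'
      exact he (Fin.ext (by simp; omega))
    · simp
  · refine Finset.sum_eq_zero fun e _ => if_neg ?_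
    have := e.2
    omega

theorem succ_mul_choose_left {n e : ℕ} (he : e ≤ n + 1) :
    ((n : ℂ) + 1) * (n.choose e : ℂ) = ((n : ℂ) + 1 - e) * ((n + 1).choose e : ℂ) := by
  have h := Nat.choose_mul_succ_eq n e
  have h' : (n.choose e : ℂ) * ((n + 1 : ℕ) : ℂ)
      = ((n + 1).choose e : ℂ) * ((n + 1 - e : ℕ) : ℂ) := by exact_mod_cast h
  rw [Nat.cast_sub he] at h'
  push_cast at h'
  linear_combination h'

theorem succ_mul_choose_right (n e : ℕ) :
    ((n : ℂ) + 1) * (n.choose e : ℂ) = ((e : ℂ) + 1) * ((n + 1).choose (e + 1) : ℂ) := by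
  have h' : ((n + 1 : ℕ) : ℂ) * (n.choose e : ℂ)
      = ((n + 1).choose (e + 1) : ℂ) * ((e + 1 : ℕ) : ℂ) := by
    exact_mod_cast Nat.add_one_mul_choose_eq n e
  push_cast at h'
  linear_combination h'

open Polynomial in
/-- Comparing coefficients in the derivative by `v` of a product of linear forms. -/
theorem symPowCoeff_polarize_one (n e j : ℕ) (hj : j ≤ n + 1) (g : Matrix (Fin 2) (Fin 2) ℂ) :
    ((e : ℂ) + 1) * symPowCoeff (n + 1) g (e + 1) j =
      ((n : ℂ) + 1 - j) * g 1 0 * symPowCoeff n g e j + j * g 1 1 * symPowCoeff n g e (j - 1) := by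
  have key : derivative ((C (g 0 0) + C (g 1 0) * X) ^ (n + 1 - j) *
      (C (g 0 1) + C (g 1 1) * X) ^ j) =
      C (((n : ℂ) + 1 - j) * g 1 0) * ((C (g 0 0) + C (g 1 0) * X) ^ (n - j) *
        (C (g 0 1) + C (g 1 1) * X) ^ j) +
      C (j * g 1 1) * ((C (g 0 0) + C (g 1 0) * X) ^ (n + 1 - j) *
        (C (g 0 1) + C (g 1 1) * X) ^ (j - 1)) := by
    rw [derivative_mul, derivative_pow, derivative_pow, Nat.cast_sub hj,
      show n + 1 - j - 1 = n - j by omega]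
    simp only [derivative_C, derivative_mul, derivative_X, C_mul, map_sub, map_add]
    simp
    ring
  have h := congrArg (fun q => coeff q e) key
  simp only [coeff_derivative, coeff_add, coeff_C_mul] at h
  rcases j with _ | j
  · simp only [symPowCoeff] at h ⊢
    simp at h ⊢
    linear_combination h
  · rw [show n + 1 - (j + 1) = n - (j + 1 - 1) by omega] at h
    simp only [symPowCoeff]
    rw [show n + 1 - (j + 1) = n - (j + 1 - 1) by omega]
    linear_combination h

open Polynomial in
/-- Comparing coefficients in the derivative by `u` of a product of linear forms. -/
theorem symPowCoeff_polarize_zero (n e j : ℕ) (hj : j ≤ n + 1) (g : Matrix (Fin 2) (Fin 2) ℂ) :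
    ((n : ℂ) + 1 - e) * symPowCoeff (n + 1) g e j =
      ((n : ℂ) + 1 - j) * g 0 0 * symPowCoeff n g e j + j * g 0 1 * symPowCoeff n g e (j - 1) := by
  obtain ⟨a, ha⟩ : ∃ a, a + j = n + 1 := ⟨n + 1 - j, by omega⟩
  have key : C ((n : ℂ) + 1) * ((C (g 0 0) + C (g 1 0) * X) ^ a *
      (C (g 0 1) + C (g 1 1) * X) ^ j) - X * derivative ((C (g 0 0) + C (g 1 0) * X) ^ a *
      (C (g 0 1) + C (g 1 1) * X) ^ j) =
      C ((a : ℂ) * g 0 0) * ((C (g 0 0) + C (g 1 0) * X) ^ (a - 1) *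
        (C (g 0 1) + C (g 1 1) * X) ^ j) +
      C (j * g 0 1) * ((C (g 0 0) + C (g 1 0) * X) ^ a *
        (C (g 0 1) + C (g 1 1) * X) ^ (j - 1)) := by
    have hn : ((n : ℂ) + 1) = a + j := by exact_mod_cast ha.symm
    rw [hn, derivative_mul, derivative_pow, derivative_pow]
    rcases a with _ | a <;> rcases j with _ | j <;>
    · simp
      try ring
  have hX : ∀ q : ℂ[X], coeff (X * derivative q) e = e * coeff q e := by
    intro q
    rcases e with _ | e
    · simp
    · rw [coeff_X_mul, coeff_derivative]; push_cast; ring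
  have hn : ((n : ℂ) + 1 - j) = a := by
    rw [sub_eq_iff_eq_add]; exact_mod_cast ha.symm
  have h := congrArg (fun q => coeff q e) key
  simp only [coeff_sub, coeff_add, coeff_C_mul, hX] at h
  rw [hn]
  simp only [symPowCoeff]
  rw [show n + 1 - j = a by omega, show n - j = a - 1 by omega]
  rcases j with _ | j
  · simp at h ⊢
    linear_combination h
  · rw [show n - (j + 1 - 1) = a by omega]
    linear_combination h

open Polynomial in
/-- The identity `g₀₀ Q - g₀₁ P = det g · v` for the linear forms `P = g₀₀ u + g₁₀ v` and
`Q = g₀₁ u + g₁₁ v`, multiplied by `P^(l-j) Q^j` and read off coefficientwise. -/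
theorem symPowCoeff_wedge_zero (l e j : ℕ) (hj : j ≤ l) (g : Matrix (Fin 2) (Fin 2) ℂ)
    (hg : g.det = 1) :
    g 0 0 * symPowCoeff (l + 1) g e (j + 1) - g 0 1 * symPowCoeff (l + 1) g e j =
      if e = 0 then 0 else symPowCoeff l g (e - 1) j := by
  rw [Matrix.det_fin_two] at hg
  have key : C (g 0 0) * ((C (g 0 0) + C (g 1 0) * X) ^ (l - j) *
        (C (g 0 1) + C (g 1 1) * X) ^ (j + 1)) -
      C (g 0 1) * ((C (g 0 0) + C (g 1 0) * X) ^ (l - j + 1) *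
        (C (g 0 1) + C (g 1 1) * X) ^ j) =
      X * ((C (g 0 0) + C (g 1 0) * X) ^ (l - j) *
        (C (g 0 1) + C (g 1 1) * X) ^ j) := by
    have : C (g 0 0) * C (g 1 1) - C (g 0 1) * C (g 1 0) = (1 : ℂ[X]) := by
      rw [← C_mul, ← C_mul, ← C_sub, hg, C_1]
    linear_combination (X * ((C (g 0 0) + C (g 1 0) * X) ^ (l - j) *
        (C (g 0 1) + C (g 1 1) * X) ^ j)) * this
  have h := congrArg (fun q => coeff q e) key
  simp only [coeff_sub, coeff_C_mul] at h
  simp only [symPowCoeff]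
  rw [show l + 1 - (j + 1) = l - j by omega, show l + 1 - j = l - j + 1 by omega, h]
  rcases e with _ | e
  · simp
  · simp [coeff_X_mul]

open Polynomial in
/-- The identity `g₁₀ Q - g₁₁ P = -det g · u` for the linear forms `P = g₀₀ u + g₁₀ v` and
`Q = g₀₁ u + g₁₁ v`, multiplied by `P^(l-j) Q^j` and read off coefficientwise. -/
theorem symPowCoeff_wedge_one (l e j : ℕ) (hj : j ≤ l) (g : Matrix (Fin 2) (Fin 2) ℂ)
    (hg : g.det = 1) :
    g 1 0 * symPowCoeff (l + 1) g e (j + 1) - g 1 1 * symPowCoeff (l + 1) g e j =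
      - symPowCoeff l g e j := by
  rw [Matrix.det_fin_two] at hg
  have key : C (g 1 0) * ((C (g 0 0) + C (g 1 0) * X) ^ (l - j) *
        (C (g 0 1) + C (g 1 1) * X) ^ (j + 1)) -
      C (g 1 1) * ((C (g 0 0) + C (g 1 0) * X) ^ (l - j + 1) *
        (C (g 0 1) + C (g 1 1) * X) ^ j) =
      - ((C (g 0 0) + C (g 1 0) * X) ^ (l - j) *
        (C (g 0 1) + C (g 1 1) * X) ^ j) := by
    have : C (g 0 0) * C (g 1 1) - C (g 0 1) * C (g 1 0) = (1 : ℂ[X]) := by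
      rw [← C_mul, ← C_mul, ← C_sub, hg, C_1]
    linear_combination (-((C (g 0 0) + C (g 1 0) * X) ^ (l - j) *
        (C (g 0 1) + C (g 1 1) * X) ^ j)) * this
  have h := congrArg (fun q => coeff q e) key
  simp only [coeff_sub, coeff_C_mul, coeff_neg] at h
  simp only [symPowCoeff]
  rw [show l + 1 - (j + 1) = l - j by omega, show l + 1 - j = l - j + 1 by omega, h]

theorem symPowCoeff_eq_zero_of_lt {k i j : ℕ} (hj : j ≤ k) (hi : k < i)
    (g : Matrix (Fin 2) (Fin 2) ℂ) : symPowCoeff k g i j = 0 := by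
  apply Polynomial.coeff_eq_zero_of_natDegree_lt
  have h1 : ∀ a b : ℂ, (Polynomial.C a + Polynomial.C b * Polynomial.X).natDegree ≤ 1 := by
    intro a b
    compute_degree
  calc _ ≤ (k - j) * 1 + j * 1 :=
        Polynomial.natDegree_mul_le_of_le
          (Polynomial.natDegree_pow_le_of_le _ (h1 _ _))
          (Polynomial.natDegree_pow_le_of_le _ (h1 _ _))
    _ < i := by omega

/-- The isometry `H_(n+1) → H_1 ⊗ H_n` that sends a binary form `f` to its polarization
`(u ⊗ ∂f/∂u + v ⊗ ∂f/∂v) / (n+1)`, in the canonical bases. -/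
def polarization (n : ℕ) : Matrix (Fin (1 + 1) × Fin (n + 1)) (Fin (n + 1 + 1)) ℂ :=
  Matrix.of fun x j =>
    if (x.1 : ℕ) + (x.2 : ℕ) = j then binomRoot n x.2 / binomRoot (n + 1) j else 0

/-- The normalization that makes `wedgeEmbedding l` an isometry. -/
def wedgeNorm (l : ℕ) : ℂ := ((Real.sqrt ((l + 1) / (l + 2)) : ℝ) : ℂ)

theorem wedgeNorm_mul_self (l : ℕ) : wedgeNorm l * wedgeNorm l = ((l : ℂ) + 1) / (l + 2) := by
  rw [wedgeNorm, ← Complex.ofReal_mul, Real.mul_self_sqrt (by positivity)]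
  push_cast
  rfl

theorem star_wedgeNorm (l : ℕ) : star (wedgeNorm l) = wedgeNorm l := by
  simp [wedgeNorm]

/-- The isometry `H_l → H_1 ⊗ H_(l+1)` that sends a binary form `f` to a multiple of
`u ⊗ v f - v ⊗ u f`, in the canonical bases. -/
def wedgeEmbedding (l : ℕ) : Matrix (Fin (1 + 1) × Fin (l + 1 + 1)) (Fin (l + 1)) ℂ :=
  Matrix.of fun x j => if (x.1 : ℕ) + (x.2 : ℕ) = j + 1 then
    (-1) ^ (x.1 : ℕ) * wedgeNorm l * (binomRoot l j / binomRoot (l + 1) x.2) else 0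

/-! ### Intertwining and isometry -/

theorem spinRep_kronecker_mul_apply {m k : ℕ} (g : Matrix.specialUnitaryGroup (Fin 2) ℂ)
    (α : Matrix (Fin (1 + 1) × Fin (m + 1)) (Fin (k + 1)) ℂ) (b : Fin (1 + 1)) (e : Fin (m + 1))
    (j : Fin (k + 1)) :
    ((spinRep 1 g ⊗ₖ spinRep m g) * α) (b, e) j =
      g.1 b 0 * ∑ e', spinRep m g e e' * α (0, e') j +
        g.1 b 1 * ∑ e', spinRep m g e e' * α (1, e') j := by
  rw [Matrix.mul_apply, Fintype.sum_prod_type, Fin.sum_univ_two, Finset.mul_sum, Finset.mul_sum]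
  simp only [Matrix.kroneckerMap_apply]
  congr 1 <;> refine Finset.sum_congr rfl fun e' _ => ?_
  · rw [spinRep_one_apply]; ring
  · rw [spinRep_one_apply]; ring

theorem polarization_intertwines (n : ℕ) (g : Matrix.specialUnitaryGroup (Fin 2) ℂ) :
    (spinRep 1 g ⊗ₖ spinRep n g) * polarization n = polarization n * spinRep (n + 1) g := by
  ext ⟨b, e⟩ j
  have hs : ∀ b' : Fin (1 + 1), ∑ e' : Fin (n + 1), spinRep n g e e' * polarization n (b', e') j =
      if (b' : ℕ) ≤ j ∧ (j : ℕ) < b' + (n + 1) then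
        (n.choose (j - b') : ℂ) * symPowCoeff n g.1 e (j - b') /
          (binomRoot n e * binomRoot (n + 1) j) else 0 := by
    intro b'
    rw [← sum_fin_ite_add_eq (n + 1) b' j fun e' => (n.choose e' : ℂ) * symPowCoeff n g.1 e e' /
      (binomRoot n e * binomRoot (n + 1) j)]
    refine Finset.sum_congr rfl fun e' _ => ?_
    simp only [polarization, Matrix.of_apply, spinRep_apply]
    split_ifs
    · rw [← binomRoot_mul_self]
      field_simp
    · simp
  have hr : (polarization n * spinRep (n + 1) g) (b, e) j =
      (binomRoot n e / binomRoot (n + 1) (b + e)) *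
        (binomRoot (n + 1) j / binomRoot (n + 1) (b + e) * symPowCoeff (n + 1) g.1 (b + e) j) := by
    rw [Matrix.mul_apply, Finset.sum_eq_single ⟨b + e, by omega⟩]
    · simp [polarization, spinRep_apply]
    · intro i _ hi
      have : ¬ ((b : ℕ) + (e : ℕ) = i) := fun h => hi (Fin.ext h.symm)
      simp [polarization, this]
    · simp
  rw [spinRep_kronecker_mul_apply, hs, hs, hr]
  have hj : (j : ℕ) ≤ n + 1 := by omega
  have he : (e : ℕ) ≤ n := by omega
  have hn : ((n : ℂ) + 1) ≠ 0 := by exact_mod_cast n.succ_ne_zero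
  -- the summand at `e' = j` vanishes for `j = n + 1`, the one at `e' = j - 1` needs `j ≥ 1`
  have h0 : (if ((0 : Fin (1 + 1)) : ℕ) ≤ (j : ℕ) ∧ (j : ℕ) < ((0 : Fin (1 + 1)) : ℕ) + (n + 1)
      then (n.choose ((j : ℕ) - ((0 : Fin (1 + 1)) : ℕ)) : ℂ) *
          symPowCoeff n g.1 e ((j : ℕ) - ((0 : Fin (1 + 1)) : ℕ)) /
          (binomRoot n e * binomRoot (n + 1) j) else 0) =
      ((n : ℂ) + 1 - j) / (n + 1) * ((n + 1).choose j : ℂ) * symPowCoeff n g.1 e j /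
          (binomRoot n e * binomRoot (n + 1) j) := by
    have h := succ_mul_choose_left hj
    split_ifs with hc
    · simp only [Fin.val_zero, Nat.sub_zero]
      congr 2
      field_simp
      linear_combination h
    · have : (j : ℕ) = n + 1 := by simp at hc; omega
      rw [this]
      simp
  have h1 : (if ((1 : Fin (1 + 1)) : ℕ) ≤ (j : ℕ) ∧ (j : ℕ) < ((1 : Fin (1 + 1)) : ℕ) + (n + 1)
      then (n.choose ((j : ℕ) - ((1 : Fin (1 + 1)) : ℕ)) : ℂ) *
          symPowCoeff n g.1 e ((j : ℕ) - ((1 : Fin (1 + 1)) : ℕ)) /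
          (binomRoot n e * binomRoot (n + 1) j) else 0) =
      (j : ℂ) / (n + 1) * ((n + 1).choose j : ℂ) * symPowCoeff n g.1 e (j - 1) /
          (binomRoot n e * binomRoot (n + 1) j) := by
    have hv : ((1 : Fin (1 + 1)) : ℕ) = 1 := rfl
    rw [hv]
    generalize (j : ℕ) = j' at *
    rcases j' with _ | j'
    · simp
    · have h := succ_mul_choose_right n j'
      rw [if_pos (by omega)]
      congr 2
      push_cast
      field_simp
      linear_combination h
  rw [h0, h1, ← binomRoot_mul_self (n + 1) j]
  have hbj : binomRoot (n + 1) j ≠ 0 := binomRoot_ne_zero hj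
  have hbe : binomRoot n e ≠ 0 := binomRoot_ne_zero he
  have hbe2 := binomRoot_mul_self n e
  generalize (j : ℕ) = j' at *
  generalize (e : ℕ) = e' at *
  fin_cases b
  · have hb2 : binomRoot (n + 1) e' ≠ 0 := binomRoot_ne_zero (by omega)
    have hb3 := binomRoot_mul_self (n + 1) e'
    have key := symPowCoeff_polarize_zero n e' j' hj g.1
    have hc := succ_mul_choose_left (n := n) (e := e') (by omega)
    simp only [Fin.zero_eta, Nat.zero_add]
    field_simp
    rw [sq, sq, hb3, hbe2]
    linear_combination (-((n + 1).choose e' : ℂ)) * key - symPowCoeff (n + 1) g.1 e' j' * hc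
  · have hb2 : binomRoot (n + 1) (1 + e') ≠ 0 := binomRoot_ne_zero (by omega)
    have hb3 := binomRoot_mul_self (n + 1) (1 + e')
    have key := symPowCoeff_polarize_one n e' j' hj g.1
    have hc := succ_mul_choose_right n e'
    rw [add_comm e' 1] at key hc
    simp only [Fin.mk_one]
    field_simp
    rw [sq, sq, hb3, hbe2]
    linear_combination (-((n + 1).choose (1 + e') : ℂ)) * key
      - symPowCoeff (n + 1) g.1 (1 + e') j' * hc

theorem wedgeEmbedding_intertwines (l : ℕ) (g : Matrix.specialUnitaryGroup (Fin 2) ℂ) :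
    (spinRep 1 g ⊗ₖ spinRep (l + 1) g) * wedgeEmbedding l = wedgeEmbedding l * spinRep l g := by
  ext ⟨b, e⟩ j
  set κ : ℂ := wedgeNorm l with hκ
  have hdet : g.1.det = 1 := (Matrix.mem_specialUnitaryGroup_iff.1 g.2).2
  have hs : ∀ b' : Fin (1 + 1),
      ∑ e' : Fin (l + 1 + 1), spinRep (l + 1) g e e' * wedgeEmbedding l (b', e') j =
      if (b' : ℕ) ≤ j + 1 ∧ (j : ℕ) + 1 < b' + (l + 1 + 1) then
        (-1) ^ (b' : ℕ) * κ * binomRoot l j / binomRoot (l + 1) e *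
          symPowCoeff (l + 1) g.1 e (j + 1 - b') else 0 := by
    intro b'
    rw [← sum_fin_ite_add_eq (l + 1 + 1) b' (j + 1) fun e' => (-1) ^ (b' : ℕ) * κ *
      binomRoot l j / binomRoot (l + 1) e * symPowCoeff (l + 1) g.1 e e']
    refine Finset.sum_congr rfl fun e' _ => ?_
    have := binomRoot_ne_zero (k := l + 1) (j := e') (by omega)
    simp only [wedgeEmbedding, Matrix.of_apply, spinRep_apply, ← hκ]
    split_ifs
    · field_simp
    · simp
  have hr : (wedgeEmbedding l * spinRep l g) (b, e) j =
      if (b : ℕ) + e = 0 then 0 else (-1) ^ (b : ℕ) * κ * binomRoot l j / binomRoot (l + 1) e *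
          symPowCoeff l g.1 (b + e - 1) j := by
    rw [Matrix.mul_apply]
    split_ifs with h
    · refine Finset.sum_eq_zero fun i _ => ?_
      simp [wedgeEmbedding, h]
    · by_cases h2 : (b : ℕ) + e = l + 2
      · rw [h2, symPowCoeff_eq_zero_of_lt (by omega) (by omega), mul_zero]
        refine Finset.sum_eq_zero fun i _ => ?_
        have : ¬ (l + 2 = i + 1) := by omega
        simp [wedgeEmbedding, h2, this]
      · rw [Finset.sum_eq_single ⟨b + e - 1, by omega⟩]
        · have h3 : (b : ℕ) + e = b + e - 1 + 1 := by omega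
          have := binomRoot_ne_zero (k := l) (j := b + e - 1) (by omega)
          simp only [wedgeEmbedding, Matrix.of_apply, spinRep_apply, ← hκ]
          rw [if_pos h3]
          field_simp
        · intro i _ hi
          have : ¬ ((b : ℕ) + (e : ℕ) = i + 1) := fun h => hi (Fin.ext (by simp; omega))
          simp [wedgeEmbedding, this]
        · simp
  rw [spinRep_kronecker_mul_apply, hs, hs, hr]
  have hv : ((1 : Fin (1 + 1)) : ℕ) = 1 := rfl
  have hj : (j : ℕ) ≤ l := by omega
  rw [hv, if_pos (by simp; omega), if_pos (by omega)]
  simp only [Fin.val_zero, Nat.sub_zero, Nat.add_sub_cancel]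
  fin_cases b
  · have key := symPowCoeff_wedge_zero l e j hj g.1 hdet
    simp only [Fin.zero_eta, Nat.zero_add]
    split_ifs at key ⊢ with h
    · linear_combination (κ * binomRoot l j / binomRoot (l + 1) e) * key
    · linear_combination (κ * binomRoot l j / binomRoot (l + 1) e) * key
  · have key := symPowCoeff_wedge_one l e j hj g.1 hdet
    simp only [Fin.mk_one]
    rw [if_neg (by omega), Nat.add_sub_cancel_left]
    linear_combination (κ * binomRoot l j / binomRoot (l + 1) e) * key

theorem polarization_isometry (n : ℕ) : (polarization n).conjTranspose * polarization n = 1 := by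
  ext i j
  rw [Matrix.mul_apply, Fintype.sum_prod_type, Fin.sum_univ_two]
  simp only [Matrix.conjTranspose_apply]
  have hs : ∀ b : Fin (1 + 1), ∑ e : Fin (n + 1),
      star (polarization n (b, e) i) * polarization n (b, e) j =
      if (b : ℕ) ≤ j ∧ (j : ℕ) < b + (n + 1) then if i = j then
        (n.choose (j - b) : ℂ) / ((n + 1).choose j : ℂ) else 0 else 0 := by
    intro b
    rw [← sum_fin_ite_add_eq (n + 1) b j fun e => if i = j then
        (n.choose e : ℂ) / ((n + 1).choose j : ℂ) else 0]
    refine Finset.sum_congr rfl fun e _ => ?_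
    simp only [polarization, Matrix.of_apply]
    by_cases hj : (b : ℕ) + (e : ℕ) = j
    · rw [if_pos hj, if_pos hj]
      by_cases hij : i = j
      · subst hij
        simp only [if_pos hj, if_true, star_div₀, star_binomRoot, ← binomRoot_mul_self]
        field_simp
      · have : ¬ (b : ℕ) + (e : ℕ) = i := fun h => hij (Fin.ext (h.symm.trans hj))
        simp [if_neg this, hij]
    · simp [hj]
  rw [hs, hs]
  by_cases hij : i = j
  · subst hij
    have hi : (i : ℕ) ≤ n + 1 := by omega
    have hc : ((n + 1).choose i : ℂ) ≠ 0 := by exact_mod_cast (Nat.choose_pos hi).ne'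
    have hv : ((1 : Fin (1 + 1)) : ℕ) = 1 := rfl
    simp only [if_true, Matrix.one_apply_eq, hv, Fin.val_zero]
    generalize (i : ℕ) = i' at *
    rcases i' with _ | i'
    · simp
    · rw [if_pos (by omega : 1 ≤ i' + 1 ∧ i' + 1 < 1 + (n + 1)), Nat.choose_succ_succ']
      rw [Nat.choose_succ_succ'] at hc
      push_cast at hc ⊢
      split_ifs with h
      · field_simp
        ring
      · have : i' = n := by simp at h; omega
        subst this
        simp
  · simp [hij]

theorem wedgeEmbedding_isometry (l : ℕ) :
    (wedgeEmbedding l).conjTranspose * wedgeEmbedding l = 1 := by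
  ext i j
  rw [Matrix.mul_apply, Fintype.sum_prod_type, Fin.sum_univ_two]
  simp only [Matrix.conjTranspose_apply]
  set κ : ℂ := wedgeNorm l with hκ
  have hκ2 : κ * κ = ((l : ℂ) + 1) / (l + 2) := wedgeNorm_mul_self l
  have hκs : star κ = κ := star_wedgeNorm l
  have hs : ∀ b : Fin (1 + 1), ∑ e : Fin (l + 1 + 1),
      star (wedgeEmbedding l (b, e) i) * wedgeEmbedding l (b, e) j =
      if (b : ℕ) ≤ j + 1 ∧ (j : ℕ) + 1 < b + (l + 1 + 1) then if i = j then
        κ * κ * (l.choose j : ℂ) / ((l + 1).choose (j + 1 - b) : ℂ) else 0 else 0 := by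
    intro b
    rw [← sum_fin_ite_add_eq (l + 1 + 1) b (j + 1) fun e => if i = j then
        κ * κ * (l.choose j : ℂ) / ((l + 1).choose e : ℂ) else 0]
    refine Finset.sum_congr rfl fun e _ => ?_
    simp only [wedgeEmbedding, Matrix.of_apply, ← hκ]
    by_cases hj : (b : ℕ) + (e : ℕ) = j + 1
    · rw [if_pos hj, if_pos hj]
      by_cases hij : i = j
      · subst hij
        have h1 : ((-1 : ℂ) ^ (b : ℕ)) * (-1 : ℂ) ^ (b : ℕ) = 1 := by
          rw [← mul_pow]; simp
        have h2 := binomRoot_ne_zero (k := l + 1) (j := e) (by omega)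
        simp only [if_pos hj, if_true, star_mul', star_div₀, star_binomRoot, hκs,
          ← binomRoot_mul_self, star_pow, star_neg, star_one]
        field_simp
        linear_combination (κ ^ 2 * binomRoot l i ^ 2) * h1
      · have : ¬ (b : ℕ) + (e : ℕ) = i + 1 := fun h => hij (Fin.ext (by omega))
        simp [if_neg this, hij]
    · simp [hj]
  rw [hs, hs]
  by_cases hij : i = j
  · subst hij
    have hi : (i : ℕ) ≤ l := by omega
    have hv : ((1 : Fin (1 + 1)) : ℕ) = 1 := rfl
    have hc1 : ((l + 1).choose i : ℂ) ≠ 0 := by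
      exact_mod_cast (Nat.choose_pos (by omega : (i : ℕ) ≤ l + 1)).ne'
    have hc2 : ((l + 1).choose (i + 1) : ℂ) ≠ 0 := by
      exact_mod_cast (Nat.choose_pos (by omega : (i : ℕ) + 1 ≤ l + 1)).ne'
    have h1 := succ_mul_choose_left (n := l) (e := i) (by omega)
    have h2 := succ_mul_choose_right l i
    have hl : (l : ℂ) + 2 ≠ 0 := by exact_mod_cast (by omega : l + 2 ≠ 0)
    simp only [if_true, Matrix.one_apply_eq, hv, Fin.val_zero, Nat.sub_zero, Nat.add_sub_cancel]
    rw [if_pos (by omega), if_pos (by omega), hκ2]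
    field_simp
    linear_combination ((l + 1).choose i : ℂ) * h2 + ((l + 1).choose (i + 1) : ℂ) * h1
  · simp [hij]

theorem isClebschGordanIsometry_polarization (n : ℕ) :
    IsClebschGordanIsometry 1 n (n + 1) (polarization n) :=
  ⟨polarization_isometry n, polarization_intertwines n⟩

theorem isClebschGordanIsometry_wedgeEmbedding (l : ℕ) :
    IsClebschGordanIsometry 1 (l + 1) l (wedgeEmbedding l) :=
  ⟨wedgeEmbedding_isometry l, wedgeEmbedding_intertwines l⟩

/-! ### Uniqueness of the Clebsch-Gordan isometries -/

/-- The element of `SU(2)` with first column `(a, b)`, where `|a|² + |b|² = 1`. -/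
def specialUnitaryOfColumn (a b : ℂ) (h : a * star a + b * star b = 1) :
    Matrix.specialUnitaryGroup (Fin 2) ℂ :=
  ⟨!![a, -star b; b, star a], by
    rw [Matrix.mem_specialUnitaryGroup_iff, Matrix.mem_unitaryGroup_iff']
    constructor
    · ext i j
      fin_cases i <;> fin_cases j <;>
        simp [Matrix.mul_apply, Fin.sum_univ_two, Matrix.star_apply] <;>
        simp only [Complex.star_def] at h <;> first | linear_combination h | ring
    · rw [Matrix.det_fin_two_of]
      linear_combination h⟩

/-- `π_1 ⊗ π_m` and `π_k` are intertwined by `γ : H_k → H_1 ⊗ H_m`. -/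
def Intertwines (m k : ℕ) (γ : Matrix (Fin (1 + 1) × Fin (m + 1)) (Fin (k + 1)) ℂ) : Prop :=
  ∀ g : Matrix.specialUnitaryGroup (Fin 2) ℂ,
    (spinRep 1 g ⊗ₖ spinRep m g) * γ = γ * spinRep k g

theorem Intertwines.sub_smul {m k : ℕ} {γ γ' : Matrix (Fin (1 + 1) × Fin (m + 1)) (Fin (k + 1)) ℂ}
    (h : Intertwines m k γ) (h' : Intertwines m k γ') (c : ℂ) :
    Intertwines m k (γ - c • γ') := by
  intro g
  rw [Matrix.mul_sub, Matrix.sub_mul, Matrix.mul_smul, Matrix.smul_mul, h g, h' g]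

theorem spinRep_diagonal (k : ℕ) (z : ℂ) (h : z * star z + 0 * star 0 = 1) :
    spinRep k (specialUnitaryOfColumn z 0 h) =
      Matrix.diagonal fun i : Fin (k + 1) => z ^ (k - (i : ℕ)) * star z ^ (i : ℕ) := by
  ext i j
  have hj := binomRoot_ne_zero (k := k) (j := j) (by omega)
  have hc : symPowCoeff k (specialUnitaryOfColumn z 0 h).1 i j =
      if i = j then z ^ (k - (j : ℕ)) * star z ^ (j : ℕ) else 0 := by
    simp only [symPowCoeff, specialUnitaryOfColumn, Matrix.of_apply, Matrix.cons_val',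
      Matrix.cons_val_zero, Matrix.cons_val_one, star_zero, neg_zero, Polynomial.C_0, zero_mul,
      add_zero, zero_add,
      Matrix.cons_val_fin_one]
    rw [mul_pow, ← Polynomial.C_pow, ← Polynomial.C_pow, ← mul_assoc, ← Polynomial.C_mul,
      Polynomial.coeff_C_mul_X_pow]
    simp [Fin.ext_iff]
  rw [spinRep_apply, hc, Matrix.diagonal_apply]
  split_ifs with hij
  · subst hij
    field_simp
  · simp

theorem IsPrimitiveRoot.mul_star_self {N : ℕ} {z : ℂ} (hz : IsPrimitiveRoot z N) (hN : N ≠ 0) :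
    z * star z = 1 := by
  rw [Complex.star_def, Complex.mul_conj, Complex.normSq_eq_norm_sq, hz.norm'_eq_one hN]
  simp

/-- Weights are preserved by an intertwiner, by its commutation with the maximal torus. -/
theorem Intertwines.weight_eq {m k : ℕ}
    {γ : Matrix (Fin (1 + 1) × Fin (m + 1)) (Fin (k + 1)) ℂ} (h : Intertwines m k γ)
    {b : Fin (1 + 1)} {e : Fin (m + 1)} {j : Fin (k + 1)} (hγ : γ (b, e) j ≠ 0) :
    1 + m + 2 * (j : ℕ) = k + 2 * ((b : ℕ) + e) := by
  -- the order of the root of unity exceeds every difference of weights that occurs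
  obtain ⟨z, hz⟩ : ∃ z : ℂ, IsPrimitiveRoot z (m + k + 2) :=
    ⟨_, Complex.isPrimitiveRoot_exp _ (by omega)⟩
  have hzz : z * star z = 1 := hz.mul_star_self (by omega)
  have hz0 : z ≠ 0 := left_ne_zero_of_mul_eq_one hzz
  have hzs : star z = z⁻¹ := (inv_eq_of_mul_eq_one_right hzz).symm
  have hg := congrFun (congrFun (h (specialUnitaryOfColumn z 0 (by simpa using hzz))) (b, e)) j
  rw [spinRep_diagonal, spinRep_diagonal, spinRep_diagonal, Matrix.diagonal_kronecker_diagonal,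
    Matrix.diagonal_mul, Matrix.mul_diagonal, mul_comm (γ _ _)] at hg
  have hg' := mul_right_cancel₀ hγ hg
  simp only [hzs, inv_pow] at hg'
  have hp : z ^ ((1 - (b : ℕ)) + (m - e) + j) = z ^ ((k - j) + (b + e)) := by
    rw [pow_add, pow_add, pow_add, pow_add z b]
    field_simp at hg'
    linear_combination hg'
  have := hz.pow_inj (by omega) (by omega) hp
  omega

theorem Intertwines.highest_weight_eq {m k : ℕ}
    {γ : Matrix (Fin (1 + 1) × Fin (m + 1)) (Fin (k + 1)) ℂ} (h : Intertwines m k γ)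
    {b : Fin (1 + 1)} {e : Fin (m + 1)} (hγ : γ (b, e) 0 ≠ 0) :
    1 + m = k + 2 * ((b : ℕ) + e) :=
  h.weight_eq hγ

/-- A rotation all of whose matrix entries are nonzero. -/
def genericRotation : Matrix.specialUnitaryGroup (Fin 2) ℂ :=
  specialUnitaryOfColumn (3 / 5) (4 / 5) (by norm_num [Complex.ext_iff])

open Polynomial in
theorem symPowCoeff_zero_right (k i : ℕ) (g : Matrix (Fin 2) (Fin 2) ℂ) :
    symPowCoeff k g i 0 = g 1 0 ^ i * g 0 0 ^ (k - i) * (k.choose i : ℂ) := by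
  have h : ∀ m, (C (g 1 0) * X) ^ m * C (g 0 0) ^ (k - m) * ((k.choose m : ℕ) : ℂ[X]) =
      C (g 1 0 ^ m * g 0 0 ^ (k - m) * (k.choose m : ℂ)) * X ^ m := by
    intro m
    rw [mul_pow, C_mul, C_mul, C_pow, C_pow, ← C_eq_natCast]
    ring
  rw [symPowCoeff, pow_zero, mul_one, Nat.sub_zero, add_comm, add_pow, finsetSum_coeff]
  simp only [h, coeff_C_mul_X_pow]
  rw [Finset.sum_ite_eq, ite_eq_left_iff]
  intro hi
  rw [Nat.choose_eq_zero_of_lt (by simpa using hi)]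
  simp

theorem spinRep_genericRotation_ne_zero (k : ℕ) (i : Fin (k + 1)) :
    spinRep k genericRotation i 0 ≠ 0 := by
  have h1 := binomRoot_ne_zero (k := k) (j := i) (by omega)
  have h2 : (k.choose i : ℂ) ≠ 0 := by
    exact_mod_cast (Nat.choose_pos (by omega : (i : ℕ) ≤ k)).ne'
  rw [spinRep_apply, Fin.val_zero, symPowCoeff_zero_right, binomRoot_zero_right]
  simp [genericRotation, specialUnitaryOfColumn, h1, h2]

/-- The orbit of the highest weight vector spans `H_k`, so an intertwiner is determined by its
value there. Since weights are preserved, a single group element is enough. -/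
theorem Intertwines.eq_zero {m k : ℕ}
    {γ : Matrix (Fin (1 + 1) × Fin (m + 1)) (Fin (k + 1)) ℂ} (h : Intertwines m k γ)
    (h0 : ∀ x, γ x 0 = 0) : γ = 0 := by
  ext ⟨b, e⟩ j
  by_contra hj
  rw [Matrix.zero_apply] at hj
  have hg := congrFun (congrFun (h genericRotation) (b, e)) 0
  rw [Matrix.mul_apply, Matrix.mul_apply, Finset.sum_eq_zero (fun x _ => by rw [h0, mul_zero]),
    Finset.sum_eq_single j] at hg
  · exact mul_ne_zero hj (spinRep_genericRotation_ne_zero k j) hg.symm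
  · intro i _ hi
    by_contra hne
    have h1 := h.weight_eq hj
    have h2 := h.weight_eq (left_ne_zero_of_mul hne)
    exact hi (Fin.ext (by omega))
  · simp

theorem Intertwines.eq_smul_polarization {n : ℕ}
    {α : Matrix (Fin (1 + 1) × Fin (n + 1)) (Fin (n + 1 + 1)) ℂ} (h : Intertwines n (n + 1) α) :
    ∃ c : ℂ, α = c • polarization n := by
  refine ⟨α (0, 0) 0, sub_eq_zero.1
    ((h.sub_smul (polarization_intertwines n) _).eq_zero fun ⟨b, e⟩ => ?_)⟩
  by_cases hbe : b = 0 ∧ e = 0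
  · obtain ⟨rfl, rfl⟩ := hbe
    simp [polarization, binomRoot_zero_right]
  · by_contra hne
    have := (h.sub_smul (polarization_intertwines n) _).highest_weight_eq hne
    have hb : (b : ℕ) = 0 := by omega
    have he : (e : ℕ) = 0 := by omega
    exact hbe ⟨Fin.ext hb, Fin.ext he⟩

/-- The image of the highest weight vector of `H_l` in `H_1 ⊗ H_(l+1)` lies in a two-dimensional
weight space. That the highest weight space of `H_1 ⊗ H_(l+1)` does not occur in the image of
`H_l` is the linear relation between its two coordinates. -/
theorem Intertwines.highest_weight_relation {l : ℕ}
    {β : Matrix (Fin (1 + 1) × Fin (l + 1 + 1)) (Fin (l + 1)) ℂ} (h : Intertwines (l + 1) l β)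
    (h01 : β (0, 1) 0 = 0) : β (1, 0) 0 = 0 := by
  have hg := congrFun (congrFun (h genericRotation) (0, 0)) 0
  rw [spinRep_kronecker_mul_apply] at hg
  have hr : (β * spinRep l genericRotation) (0, 0) 0 = 0 := by
    rw [Matrix.mul_apply]
    refine Finset.sum_eq_zero fun i _ => ?_
    by_contra hne
    have : 1 + (l + 1) + 2 * (i : ℕ) = l + 2 * (0 + 0) := h.weight_eq (left_ne_zero_of_mul hne)
    omega
  rw [hr, Finset.sum_eq_zero, Finset.sum_eq_single 0, mul_zero, zero_add] at hg
  · by_contra hne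
    exact mul_ne_zero (by simp [genericRotation, specialUnitaryOfColumn])
      (mul_ne_zero (spinRep_genericRotation_ne_zero (l + 1) 0) hne) hg
  · intro e _ he
    by_contra hne
    have : 1 + (l + 1) = l + 2 * (1 + (e : ℕ)) := h.highest_weight_eq (right_ne_zero_of_mul hne)
    have he' : (e : ℕ) = 0 := by omega
    exact he (Fin.ext he')
  · simp
  · intro e _
    by_contra hne
    have : 1 + (l + 1) = l + 2 * (0 + (e : ℕ)) := h.highest_weight_eq (right_ne_zero_of_mul hne)
    have he : e = 1 := Fin.ext (by simp; omega)
    rw [he, h01, mul_zero] at hne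
    exact hne rfl

theorem Intertwines.eq_smul_wedgeEmbedding {l : ℕ}
    {β : Matrix (Fin (1 + 1) × Fin (l + 1 + 1)) (Fin (l + 1)) ℂ} (h : Intertwines (l + 1) l β) :
    ∃ c : ℂ, β = c • wedgeEmbedding l := by
  have hw : wedgeEmbedding l (0, 1) 0 ≠ 0 := by
    have h1 := binomRoot_ne_zero (k := l + 1) (j := 1) (by omega)
    have h2 : wedgeNorm l ≠ 0 :=
      Complex.ofReal_ne_zero.2 (Real.sqrt_pos.2 (by positivity)).ne'
    simp only [wedgeEmbedding, Matrix.of_apply, Fin.val_zero, binomRoot_zero_right]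
    simp [h1, h2]
  have hs := h.sub_smul (wedgeEmbedding_intertwines l) (β (0, 1) 0 / wedgeEmbedding l (0, 1) 0)
  have h01 : (β - (β (0, 1) 0 / wedgeEmbedding l (0, 1) 0) • wedgeEmbedding l) (0, 1) 0 = 0 := by
    rw [Matrix.sub_apply, Matrix.smul_apply, smul_eq_mul, div_mul_cancel₀ _ hw, sub_self]
  refine ⟨_, sub_eq_zero.1 (hs.eq_zero fun ⟨b, e⟩ => ?_)⟩
  by_contra hne
  have hwt := hs.highest_weight_eq hne
  fin_cases b
  · have he : e = 1 := Fin.ext (by simp at hwt ⊢; omega)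
    exact hne (he ▸ h01)
  · have he' : (e : ℕ) = 0 := by simp at hwt; omega
    have he : e = 0 := Fin.ext he'
    exact hne (he ▸ hs.highest_weight_relation h01)

/-- The phase of the Stinespring operator does not affect the channel. -/
theorem stinespringMap_eq_of_eq_smul {A B E : Type*} [Fintype A] [Fintype B] [Fintype E]
    [DecidableEq A] [Nonempty A] {α α₀ : Matrix (B × E) A ℂ} {c : ℂ} (h : α = c • α₀)
    (hα : α.conjTranspose * α = 1) (hα₀ : α₀.conjTranspose * α₀ = 1) :
    stinespringMap α = stinespringMap α₀ := by
  subst h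
  have hc : c * star c = 1 := by
    rw [Matrix.conjTranspose_smul, Matrix.smul_mul, Matrix.mul_smul, hα₀, smul_smul] at hα
    obtain ⟨a⟩ := ‹Nonempty A›
    have := congrFun (congrFun hα a) a
    simp only [Matrix.smul_apply, Matrix.one_apply_eq, smul_eq_mul, mul_one] at this
    rwa [mul_comm]
  refine LinearMap.ext fun X => ?_
  change partialTraceRight _ = partialTraceRight _
  rw [Matrix.conjTranspose_smul, Matrix.smul_mul, Matrix.smul_mul, Matrix.mul_smul, smul_smul, hc,
    one_smul]

theorem IsClebschGordanIsometry.stinespringMap_eq_polarization {n : ℕ}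
    {α : Matrix (Fin (1 + 1) × Fin (n + 1)) (Fin (n + 1 + 1)) ℂ}
    (h : IsClebschGordanIsometry 1 n (n + 1) α) :
    stinespringMap α = stinespringMap (polarization n) := by
  obtain ⟨c, hc⟩ := Intertwines.eq_smul_polarization h.intertwines
  exact stinespringMap_eq_of_eq_smul hc h.isometry (polarization_isometry n)

theorem IsClebschGordanIsometry.stinespringMap_eq_wedgeEmbedding {l : ℕ}
    {β : Matrix (Fin (1 + 1) × Fin (l + 1 + 1)) (Fin (l + 1)) ℂ}
    (h : IsClebschGordanIsometry 1 (l + 1) l β) :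
    stinespringMap β = stinespringMap (wedgeEmbedding l) := by
  obtain ⟨c, hc⟩ := Intertwines.eq_smul_wedgeEmbedding h.intertwines
  exact stinespringMap_eq_of_eq_smul hc h.isometry (wedgeEmbedding_isometry l)

/-! ### Quadrature -/

/-- In finite dimension the convex hull of a compact set is compact: by Carathéodory's theorem it
is a finite union of continuous images of products of the set with simplices. -/
theorem IsCompact.convexHull_of_finiteDimensional {E : Type*} [NormedAddCommGroup E]
    [NormedSpace ℝ E] [FiniteDimensional ℝ E] {K : Set E} (hK : IsCompact K) :
    IsCompact (convexHull ℝ K) := by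
  have heq : convexHull ℝ K = ⋃ n ∈ Set.Iic (Module.finrank ℝ E + 1),
      (fun q : (Fin n → ℝ) × (Fin n → E) => ∑ i, q.1 i • q.2 i) ''
        (stdSimplex ℝ (Fin n) ×ˢ Set.univ.pi fun _ => K) := by
    apply Set.Subset.antisymm
    · intro x hx
      obtain ⟨ι, _, z, w, hz, hai, hw, hw1, hx⟩ := eq_pos_convex_span_of_mem_convexHull hx
      have hcard : Fintype.card ι ≤ Module.finrank ℝ E + 1 :=
        hai.card_le_finrank_succ.trans (Nat.add_le_add_right (Submodule.finrank_le _) 1)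
      let e := Fintype.equivFin ι
      refine Set.mem_biUnion hcard ⟨(w ∘ e.symm, z ∘ e.symm), ⟨⟨fun i => (hw _).le, ?_⟩, ?_⟩, ?_⟩
      · rw [← hw1]
        exact e.symm.sum_comp w
      · exact fun i _ => hz ⟨_, rfl⟩
      · rw [← hx]
        exact e.symm.sum_comp fun i => w i • z i
    · refine Set.iUnion₂_subset fun n _ => ?_
      rintro _ ⟨⟨w, z⟩, ⟨⟨hw, hw1⟩, hz⟩, rfl⟩
      exact (convex_convexHull ℝ K).sum_mem (fun i _ => hw i) hw1
        fun i _ => subset_convexHull ℝ K (hz i trivial)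
  rw [heq]
  refine (Set.finite_Iic _).isCompact_biUnion fun n _ => ?_
  exact ((isCompact_stdSimplex ℝ _).prod (isCompact_univ_pi fun _ => hK)).image (by fun_prop)

theorem integral_pow_mul_one_sub_pow (n k : ℕ) (hk : k ≤ n) :
    ∫ s in (0 : ℝ)..1, s ^ k * (1 - s) ^ (n - k) = 1 / ((n + 1) * n.choose k) := by
  induction k with
  | zero =>
    have : ∫ s in (0 : ℝ)..1, (1 - s) ^ n = ∫ s in (0 : ℝ)..1, s ^ n := by
      rw [intervalIntegral.integral_comp_sub_left (fun s : ℝ => s ^ n)]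
      simp
    simp [this]
  | succ k ih =>
    have ih := ih (by omega)
    obtain ⟨m, rfl⟩ : ∃ m, n = k + 1 + m := ⟨n - (k + 1), by omega⟩
    rw [show k + 1 + m - k = m + 1 by omega] at ih
    rw [Nat.add_sub_cancel_left]
    -- integrate the derivative of `s ^ (k + 1) * (1 - s) ^ (m + 1)`
    have hparts : ∫ s in (0 : ℝ)..1, (((k : ℝ) + 1) * (s ^ k * (1 - s) ^ (m + 1)) -
        ((m : ℝ) + 1) * (s ^ (k + 1) * (1 - s) ^ m)) = 0 := by
      rw [intervalIntegral.integral_eq_sub_of_hasDerivAt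
        (f := fun s : ℝ => s ^ (k + 1) * (1 - s) ^ (m + 1))]
      · simp
      · intro s _
        have h1 := (hasDerivAt_id s).pow (k + 1)
        have h2 := ((hasDerivAt_id s).const_sub 1).pow (m + 1)
        have h3 := h1.mul h2
        refine h3.congr_deriv ?_
        simp
        ring
      · exact Continuous.intervalIntegrable (by fun_prop) _ _
    rw [intervalIntegral.integral_sub, intervalIntegral.integral_const_mul,
      intervalIntegral.integral_const_mul, ih] at hparts
    · have hc := Nat.choose_succ_right_eq (k + 1 + m) k
      rw [show k + 1 + m - k = m + 1 by omega] at hc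
      have hc' : ((k + 1 + m).choose (k + 1) : ℝ) * (k + 1) =
          ((k + 1 + m).choose k : ℝ) * (m + 1) := by exact_mod_cast hc
      have h1 : ((k + 1 + m).choose (k + 1) : ℝ) ≠ 0 := by
        exact_mod_cast (Nat.choose_pos (by omega)).ne'
      have h2 : ((k + 1 + m).choose k : ℝ) ≠ 0 := by
        exact_mod_cast (Nat.choose_pos (by omega)).ne'
      have h3 : (m : ℝ) + 1 ≠ 0 := by positivity
      have h4 : ((k + 1 + m : ℕ) : ℝ) + 1 ≠ 0 := by positivity
      generalize ((k + 1 + m : ℕ) : ℝ) + 1 = N at *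
      generalize ∫ s in (0 : ℝ)..1, s ^ (k + 1) * (1 - s) ^ m = I at *
      field_simp at hparts ⊢
      have h5 : ((k + 1 + m).choose k : ℝ) * (m + 1) *
          (I * N * ((k + 1 + m).choose (k + 1) : ℝ) - 1) = 0 := by
        linear_combination hc' - ((k + 1 + m).choose (k + 1) : ℝ) * hparts
      have := (mul_eq_zero.1 h5).resolve_left (mul_ne_zero h2 h3)
      linear_combination this
    · exact Continuous.intervalIntegrable (by fun_prop) _ _
    · exact Continuous.intervalIntegrable (by fun_prop) _ _

/-- A quadrature formula with positive weights: finitely many nodes in `[0, 1]` integrate all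
polynomials of degree at most `n` exactly. It is stated on the Bernstein basis. -/
theorem exists_quadrature (n : ℕ) : ∃ (ι : Type) (_ : Fintype ι) (w s : ι → ℝ),
    (∀ k, 0 ≤ w k) ∧ ∑ k, w k = 1 ∧ (∀ k, s k ∈ Set.Icc (0 : ℝ) 1) ∧
    ∀ j ≤ n, ∑ k, w k * (s k ^ j * (1 - s k) ^ (n - j)) = 1 / ((n + 1) * n.choose j) := by
  let f : ℝ → Fin (n + 1) → ℝ := fun s j => s ^ (j : ℕ) * (1 - s) ^ (n - (j : ℕ))
  have hf : Continuous f := by fun_prop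
  have hK : IsCompact (f '' Set.Icc 0 1) := isCompact_Icc.image hf
  have hprob : MeasureTheory.IsProbabilityMeasure
      (MeasureTheory.volume.restrict (Set.Icc (0 : ℝ) 1)) := ⟨by simp⟩
  have hint : MeasureTheory.IntegrableOn f (Set.Icc 0 1) := hf.integrableOn_Icc
  have hmem : ∫ s in Set.Icc (0 : ℝ) 1, f s ∈ convexHull ℝ (f '' Set.Icc 0 1) := by
    refine (convex_convexHull ℝ _).integral_mem
      hK.convexHull_of_finiteDimensional.isClosed ?_ hint
    filter_upwards [MeasureTheory.ae_restrict_mem measurableSet_Icc] with s hs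
    exact subset_convexHull ℝ _ ⟨s, hs, rfl⟩
  obtain ⟨ι, hι, w, z, hw, hw1, hz, hsum⟩ := mem_convexHull_iff_exists_fintype.1 hmem
  choose s hs hfs using hz
  refine ⟨ι, hι, w, s, hw, hw1, hs, fun j hj => ?_⟩
  have h := congrFun hsum ⟨j, by omega⟩
  rw [← ContinuousLinearMap.proj_apply (R := ℝ) (φ := fun _ : Fin (n + 1) => ℝ) ⟨j, by omega⟩
    (∫ s in Set.Icc (0 : ℝ) 1, f s), ← ContinuousLinearMap.integral_comp_comm _ hint,
    MeasureTheory.integral_Icc_eq_integral_Ioc, ← intervalIntegral.integral_of_le zero_le_one] at h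
  simp only [ContinuousLinearMap.proj_apply, f] at h
  rw [integral_pow_mul_one_sub_pow n j hj] at h
  rw [← h, Finset.sum_apply]
  refine Finset.sum_congr rfl fun k _ => ?_
  rw [Pi.smul_apply, ← hfs k, smul_eq_mul]

/-- Orthogonality of the characters of a cyclic group, at exponents below its order. -/
theorem IsPrimitiveRoot.sum_pow_mul_star_pow {N : ℕ} {ζ : ℂ} (hζ : IsPrimitiveRoot ζ N)
    {a b : ℕ} (ha : a < N) (hb : b < N) :
    ∑ m : Fin N, (ζ ^ (m : ℕ)) ^ a * star (ζ ^ (m : ℕ)) ^ b = if a = b then (N : ℂ) else 0 := by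
  have hzz : ζ * star ζ = 1 := hζ.mul_star_self (by omega)
  have hterm : ∀ m : ℕ, (ζ ^ m) ^ a * star (ζ ^ m) ^ b = (ζ ^ a * star ζ ^ b) ^ m := by
    intro m
    rw [star_pow]
    ring
  simp only [hterm]
  rw [Fin.sum_univ_eq_sum_range fun m => (ζ ^ a * star ζ ^ b) ^ m]
  split_ifs with hab
  · subst hab
    rw [← mul_pow, hzz]
    simp
  · have hpow : (ζ ^ a * star ζ ^ b) ^ N = 1 := by
      have h1 : star ζ ^ N = 1 := by rw [← star_pow, hζ.pow_eq_one, star_one]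
      rw [mul_pow, ← pow_mul, ← pow_mul, mul_comm a, mul_comm b, pow_mul, pow_mul,
        hζ.pow_eq_one, h1]
      simp
    have hne : ζ ^ a * star ζ ^ b ≠ 1 := by
      intro h
      apply hab
      apply hζ.pow_inj ha hb
      have h1 : ζ ^ b * star ζ ^ b = 1 := by rw [← mul_pow, hzz, one_pow]
      linear_combination ζ ^ b * h - ζ ^ a * h1
    have := mul_neg_geom_sum (ζ ^ a * star ζ ^ b) N
    rw [hpow, sub_self] at this
    exact (mul_eq_zero.1 this).resolve_left (sub_ne_zero.2 hne.symm)

/-! ### Choi matrices of the Clebsch-Gordan channels -/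

theorem choiMatrix_apply {A B : Type*} [Fintype A] [DecidableEq A]
    (Φ : Matrix A A ℂ →ₗ[ℂ] Matrix B B ℂ) (x y : A × B) :
    choiMatrix Φ x y = Φ (Matrix.single x.1 y.1 1) x.2 y.2 := by
  simp only [choiMatrix, Matrix.sum_apply, Matrix.kroneckerMap_apply]
  rw [Finset.sum_eq_single x.1, Finset.sum_eq_single y.1]
  · simp
  · intro j _ hj
    simp [hj]
  · simp
  · intro i _ hi
    refine Finset.sum_eq_zero fun j _ => ?_
    simp [hi]
  · simp

theorem choiMatrix_stinespringMap_apply {A B E : Type*} [Fintype A] [DecidableEq A] [Fintype E]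
    (α : Matrix (B × E) A ℂ) (x y : A × B) :
    choiMatrix (stinespringMap α) x y = ∑ e, α (x.2, e) x.1 * star (α (y.2, e) y.1) := by
  rw [choiMatrix_apply]
  change ∑ e, (α * Matrix.single x.1 y.1 (1 : ℂ) * α.conjTranspose) (x.2, e) (y.2, e) = _
  refine Finset.sum_congr rfl fun e _ => ?_
  rw [Matrix.mul_apply, Finset.sum_eq_single y.1]
  · simp
  · intro j _ hj
    simp [Matrix.mul_single_apply_of_ne, hj]
  · simp

/-- The entries of the operators on `H_l ⊗ H_1` with the symmetry of a Choi matrix of an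
`SU(2)`-covariant map `B(H_l) → B(H_1)`. This space is two-dimensional: `l x` and `(l + 2) y` are
the coefficients of the Choi matrices of the two Clebsch-Gordan channels.
The off-diagonal entries are `(x - y) √((i + 1) (l - i))`. -/
def covariantEntry (l : ℕ) (x y : ℂ) (i : ℕ) (b : Fin 2) (j : ℕ) (b' : Fin 2) : ℂ :=
  !![if i = j then x * (l - i) + y * (i + 1) else 0,
      if i + 1 = j then (x - y) * (binomRoot l i * binomRoot l j * (i + 1) / l.choose i) else 0;
    if i = j + 1 then (x - y) * (binomRoot l i * binomRoot l j * (j + 1) / l.choose j) else 0,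
      if i = j then x * i + y * (l + 1 - i) else 0] b b'

/-- The matrix on `H_l ⊗ H_1` with entries `covariantEntry`. -/
def covariantMatrix (l : ℕ) (x y : ℂ) : Matrix (Fin (l + 1) × Fin 2) (Fin (l + 1) × Fin 2) ℂ :=
  Matrix.of fun s t => covariantEntry l x y s.1 s.2 t.1 t.2

theorem covariantMatrix_linear (l : ℕ) (a b x y x' y' : ℂ) :
    a • covariantMatrix l x y + b • covariantMatrix l x' y' =
      covariantMatrix l (a * x + b * x') (a * y + b * y') := by
  ext ⟨i, c⟩ ⟨j, c'⟩
  simp only [Matrix.add_apply, Matrix.smul_apply, covariantMatrix, Matrix.of_apply, covariantEntry,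
    smul_eq_mul]
  fin_cases c <;> fin_cases c' <;> simp <;> split_ifs <;> ring

theorem smul_covariantMatrix (l : ℕ) (a x y : ℂ) :
    a • covariantMatrix l x y = covariantMatrix l (a * x) (a * y) := by
  have := covariantMatrix_linear l a 0 x y 0 0
  simpa using this

theorem choiMatrix_polarization (n : ℕ) :
    choiMatrix (stinespringMap (polarization n)) =
      covariantMatrix (n + 1) (1 / ((n : ℂ) + 1)) 0 := by
  ext ⟨i, b⟩ ⟨j, b'⟩
  have hterm : ∀ e : Fin (n + 1), polarization n (b, e) i * star (polarization n (b', e) j) =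
      if (b : ℕ) + (e : ℕ) = i then (fun e : ℕ => if (b' : ℕ) + e = j then
        (n.choose e : ℂ) / (binomRoot (n + 1) i * binomRoot (n + 1) j) else 0) e else 0 := by
    intro e
    simp only [polarization, Matrix.of_apply]
    split_ifs
    · rw [star_div₀, star_binomRoot, star_binomRoot, ← binomRoot_mul_self]
      field_simp
    all_goals simp
  rw [choiMatrix_stinespringMap_apply, Finset.sum_congr rfl fun e _ => hterm e]
  have hsum := sum_fin_ite_add_eq (n + 1) b i (fun e : ℕ => if (b' : ℕ) + e = j then
        (n.choose e : ℂ) / (binomRoot (n + 1) i * binomRoot (n + 1) j) else 0)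
  refine hsum.trans ?_
  clear hterm hsum
  have hi : (i : ℕ) ≤ n + 1 := by omega
  have hj : (j : ℕ) ≤ n + 1 := by omega
  simp only [covariantMatrix, Matrix.of_apply]
  generalize (i : ℕ) = i' at *
  generalize (j : ℕ) = j' at *
  have hri := binomRoot_ne_zero hi
  have hrj := binomRoot_ne_zero hj
  have hsi := binomRoot_mul_self (n + 1) i'
  have hsj := binomRoot_mul_self (n + 1) j'
  have hci : ((n + 1).choose i' : ℂ) ≠ 0 := by exact_mod_cast (Nat.choose_pos hi).ne'
  have hcj : ((n + 1).choose j' : ℂ) ≠ 0 := by exact_mod_cast (Nat.choose_pos hj).ne'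
  have hn : ((n : ℂ) + 1) ≠ 0 := by exact_mod_cast n.succ_ne_zero
  have hl := succ_mul_choose_left hi
  have hr : ∀ e, _ := succ_mul_choose_right n
  fin_cases b <;> fin_cases b' <;> simp [covariantEntry]
  · by_cases hij : i' = j'
    · subst hij
      simp only [if_true]
      split_ifs with h
      · rw [hsi]
        field_simp
        linear_combination hl
      · have : i' = n + 1 := by omega
        subst this
        simp
    · simp [hij]
  · by_cases hij : i' + 1 = j'
    · subst hij
      rw [if_pos (by omega), if_pos (by omega), if_pos rfl]
      field_simp
      linear_combination ((n + 1).choose i' : ℂ) * hr i' -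
        binomRoot (n + 1) (i' + 1) ^ 2 * ((i' : ℂ) + 1) * hsi -
        ((n + 1).choose i' : ℂ) * ((i' : ℂ) + 1) * hsj
    · rw [if_neg hij, if_neg (by omega : ¬ 1 + i' = j'), ite_self]
  · by_cases hij : i' = j' + 1
    · subst hij
      rw [if_pos (by omega), if_pos (by omega), if_pos rfl, Nat.add_sub_cancel]
      field_simp
      linear_combination ((n + 1).choose j' : ℂ) * hr j' -
        binomRoot (n + 1) (j' + 1) ^ 2 * ((j' : ℂ) + 1) * hsj -
        ((n + 1).choose j' : ℂ) * ((j' : ℂ) + 1) * hsi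
    · rw [if_neg hij]
      split_ifs
      · omega
      · rfl
      · rfl
  · by_cases hij : i' = j'
    · subst hij
      rcases i' with _ | e
      · simp
      · rw [if_pos (by omega), if_pos (by omega), if_pos rfl, Nat.add_sub_cancel, hsi]
        have := hr e
        push_cast
        field_simp
        linear_combination this
    · rw [if_neg hij]
      split_ifs
      · omega
      · rfl
      · rfl

theorem choiMatrix_wedgeEmbedding (l : ℕ) :
    choiMatrix (stinespringMap (wedgeEmbedding l)) =
      covariantMatrix l 0 (1 / ((l : ℂ) + 2)) := by
  ext ⟨i, b⟩ ⟨j, b'⟩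
  set κ : ℂ := wedgeNorm l with hκ
  have hκ2 : κ * κ = ((l : ℂ) + 1) / (l + 2) := wedgeNorm_mul_self l
  have hκs : star κ = κ := star_wedgeNorm l
  have hterm : ∀ e : Fin (l + 1 + 1),
      wedgeEmbedding l (b, e) i * star (wedgeEmbedding l (b', e) j) =
      if (b : ℕ) + (e : ℕ) = i + 1 then (fun e : ℕ => if (b' : ℕ) + e = j + 1 then
        (-1) ^ (b : ℕ) * (-1) ^ (b' : ℕ) * (((l : ℂ) + 1) / (l + 2)) *
          (binomRoot l i * binomRoot l j) / ((l + 1).choose e : ℂ) else 0) e else 0 := by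
    intro e
    simp only [wedgeEmbedding, Matrix.of_apply, ← hκ]
    split_ifs
    · simp only [star_div₀, star_binomRoot, star_mul', hκs, star_pow, star_neg, star_one,
        ← binomRoot_mul_self (l + 1), ← hκ2]
      have := binomRoot_ne_zero (k := l + 1) (j := e) (by omega)
      field_simp
    all_goals simp
  rw [choiMatrix_stinespringMap_apply, Finset.sum_congr rfl fun e _ => hterm e]
  have hsum := sum_fin_ite_add_eq (l + 1 + 1) b (i + 1) (fun e : ℕ => if (b' : ℕ) + e = j + 1 then
        (-1) ^ (b : ℕ) * (-1) ^ (b' : ℕ) * (((l : ℂ) + 1) / (l + 2)) *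
          (binomRoot l i * binomRoot l j) / ((l + 1).choose e : ℂ) else 0)
  refine hsum.trans ?_
  clear hterm hsum
  have hi : (i : ℕ) ≤ l := by omega
  have hj : (j : ℕ) ≤ l := by omega
  simp only [covariantMatrix, Matrix.of_apply]
  generalize (i : ℕ) = i' at *
  generalize (j : ℕ) = j' at *
  have hsi := binomRoot_mul_self l i'
  have hci : (l.choose i' : ℂ) ≠ 0 := by exact_mod_cast (Nat.choose_pos hi).ne'
  have hcj : (l.choose j' : ℂ) ≠ 0 := by exact_mod_cast (Nat.choose_pos hj).ne'
  have hci0 : ((l + 1).choose i' : ℂ) ≠ 0 := by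
    exact_mod_cast (Nat.choose_pos (by omega : i' ≤ l + 1)).ne'
  have hci1 : ((l + 1).choose (i' + 1) : ℂ) ≠ 0 := by
    exact_mod_cast (Nat.choose_pos (by omega : i' + 1 ≤ l + 1)).ne'
  have hl2 : (l : ℂ) + 2 ≠ 0 := by exact_mod_cast (by omega : l + 2 ≠ 0)
  have hl := succ_mul_choose_left (n := l) (e := i') (by omega)
  have hr := succ_mul_choose_right l i'
  have hrj := succ_mul_choose_right l j'
  fin_cases b <;> fin_cases b' <;> simp [covariantEntry]
  · by_cases hij : i' = j'
    · subst hij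
      rw [if_pos hi, if_pos rfl, if_pos rfl, hsi]
      field_simp
      linear_combination hr
    · simp [hij]
  · by_cases hij : i' + 1 = j'
    · subst hij
      rw [if_pos (by omega), if_pos (by omega), if_pos rfl]
      field_simp
      linear_combination (-1 : ℂ) * binomRoot l i' * binomRoot l (i' + 1) * hr
    · rw [if_neg hij, if_neg (by omega : ¬ 1 + (i' + 1) = j' + 1), ite_self]
  · by_cases hij : i' = j' + 1
    · subst hij
      rw [if_pos (by omega), if_pos (by omega), if_pos rfl]
      field_simp
      linear_combination (-1 : ℂ) * binomRoot l j' * binomRoot l (j' + 1) * hrj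
    · rw [if_neg hij]
      split_ifs
      · rfl
      · rfl
  · by_cases hij : i' = j'
    · subst hij
      rw [if_pos (by omega), if_pos (by omega), if_pos rfl, hsi]
      field_simp
      linear_combination hl
    · rw [if_neg hij]
      split_ifs
      · omega
      · rfl
      · rfl

/-! ### Separability and partial transposition -/

theorem choiMatrix_add_smul {A B : Type*} [Fintype A] [DecidableEq A]
    (Φ Φ' : Matrix A A ℂ →ₗ[ℂ] Matrix B B ℂ) (a b : ℂ) :
    choiMatrix (a • Φ + b • Φ') = a • choiMatrix Φ + b • choiMatrix Φ' := by
  ext x y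
  simp [choiMatrix_apply]

theorem partialTranspose_smul {A B : Type*} (c : ℂ) (M : Matrix (A × B) (A × B) ℂ) :
    partialTranspose (c • M) = c • partialTranspose M := rfl

/-- The Peres criterion: separable operators have positive partial transpose. -/
theorem IsSeparableState.posSemidef_partialTranspose {A B : Type*} [Fintype A] [Fintype B]
    {M : Matrix (A × B) (A × B) ℂ} (h : IsSeparableState M) :
    (partialTranspose M).PosSemidef := by
  obtain ⟨n, q, ρ, σ, hq, -, hρ, hσ, rfl⟩ := h
  have heq : partialTranspose (∑ i, (q i : ℂ) • (ρ i ⊗ₖ σ i)) =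
      ∑ i, (q i : ℂ) • (ρ i ⊗ₖ (σ i).transpose) := by
    ext x y
    simp [partialTranspose, Matrix.sum_apply]
  rw [heq]
  refine Matrix.posSemidef_sum _ fun i _ => ?_
  exact ((hρ i).1.kronecker (hσ i).1.transpose).smul (Complex.zero_le_real.2 (hq i))

theorem IsEBT.isPPT {A B : Type*} [Fintype A] [DecidableEq A] [Nonempty A] [Fintype B]
    {Φ : Matrix A A ℂ →ₗ[ℂ] Matrix B B ℂ} (h : IsEBT Φ) : IsPPT Φ := by
  have hd : (Fintype.card A : ℂ) ≠ 0 := by exact_mod_cast Fintype.card_ne_zero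
  have h1 := IsSeparableState.posSemidef_partialTranspose h
  have h2 := h1.smul (a := (Fintype.card A : ℂ)) (Nat.cast_nonneg _)
  rwa [partialTranspose_smul, smul_smul, mul_inv_cancel₀ hd, one_smul] at h2

/-- A convex combination of product states may be indexed by any finite type. -/
theorem isSeparableState_of_fintype {A B ι : Type*} [Fintype A] [Fintype B] [Fintype ι]
    {M : Matrix (A × B) (A × B) ℂ} {q : ι → ℝ} {ρ : ι → Matrix A A ℂ} {σ : ι → Matrix B B ℂ}
    (hq : ∀ i, 0 ≤ q i) (hq1 : ∑ i, q i = 1) (hρ : ∀ i, IsQuantumState (ρ i))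
    (hσ : ∀ i, IsQuantumState (σ i)) (hM : M = ∑ i, (q i : ℂ) • (ρ i ⊗ₖ σ i)) :
    IsSeparableState M := by
  let e := (Fintype.equivFin ι).symm
  refine ⟨Fintype.card ι, q ∘ e, ρ ∘ e, σ ∘ e, fun i => hq _, ?_, fun i => hρ _, fun i => hσ _, ?_⟩
  · rw [← hq1]
    exact e.sum_comp q
  · rw [hM]
    exact (e.sum_comp fun i => (q i : ℂ) • (ρ i ⊗ₖ σ i)).symm

/-- The partial transpose of a covariant operator is tested on `|1⟩|0⟩ - √l |0⟩|1⟩`, a highest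
weight vector for its eigenspace of lower spin. -/
theorem le_of_posSemidef_partialTranspose {l : ℕ} (hl : 1 ≤ l) {x y : ℝ}
    (h : (partialTranspose (covariantMatrix l x y)).PosSemidef) : x ≤ (l + 2) * y := by
  obtain ⟨n, rfl⟩ : ∃ n, l = n + 1 := ⟨l - 1, by omega⟩
  let f : Fin 2 → Fin (n + 1 + 1) × Fin 2 := ![(1, 0), (0, 1)]
  have h2 := (h.submatrix f).dotProduct_mulVec_nonneg ![1, -binomRoot (n + 1) 1]
  have h1 : binomRoot (n + 1) 1 * binomRoot (n + 1) 1 = (n : ℂ) + 1 := by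
    rw [binomRoot_mul_self]; simp
  have hform : star ![1, -binomRoot (n + 1) 1] ⬝ᵥ
      ((partialTranspose (covariantMatrix (n + 1) x y)).submatrix f f).mulVec
        ![1, -binomRoot (n + 1) 1] =
      (((n + 2) * ((n + 3) * y - x) : ℝ) : ℂ) := by
    have hs := star_binomRoot (n + 1) 1
    simp only [Complex.star_def] at hs
    simp [Matrix.mulVec, dotProduct, Fin.sum_univ_two, f, partialTranspose, covariantMatrix,
      covariantEntry, hs, binomRoot_zero_right]
    linear_combination (-2 * ((x : ℂ) - y) + (n + 2) * y) * h1
  rw [hform, Complex.zero_le_real] at h2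
  have h3 := nonneg_of_mul_nonneg_right h2 (by positivity)
  push_cast
  linarith

/-! ### Coherent states and the averaged product states -/

/-- The coefficient of the spin coherent state of `ψ = (ψ₀, ψ₁) = (√(1 - s), √s ω)`: the vector
`ψ^l` in the canonical basis of `H_l`. -/
def coherentVector (l : ℕ) (s : ℝ) (ω : ℂ) (i : Fin (l + 1)) : ℂ :=
  binomRoot l i * ((Real.sqrt (1 - s) : ℝ) : ℂ) ^ (l - (i : ℕ)) *
    (((Real.sqrt s : ℝ) : ℂ) * ω) ^ (i : ℕ)

/-- The qubit state `(1 - τ) |ψ*⟩⟨ψ*| + τ |φ*⟩⟨φ*|` for `ψ = (√(1 - s), √s ω)`, a unit vector `φ`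
orthogonal to `ψ`, and `*` the complex conjugation of vectors. -/
def preparedState (τ s : ℝ) (ω : ℂ) : Matrix (Fin 2) (Fin 2) ℂ :=
  !![(((1 - τ) * (1 - s) + τ * s : ℝ) : ℂ),
      (((1 - 2 * τ) * (Real.sqrt (1 - s) * Real.sqrt s) : ℝ) : ℂ) * ω;
    (((1 - 2 * τ) * (Real.sqrt (1 - s) * Real.sqrt s) : ℝ) : ℂ) * star ω,
      (((1 - τ) * s + τ * (1 - s) : ℝ) : ℂ)]

theorem ofReal_sqrt_mul_self {x : ℝ} (hx : 0 ≤ x) :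
    ((Real.sqrt x : ℝ) : ℂ) * ((Real.sqrt x : ℝ) : ℂ) = x := by
  rw [← Complex.ofReal_mul, Real.mul_self_sqrt hx]

theorem isQuantumState_preparedState {τ s : ℝ} (hτ0 : 0 ≤ τ) (hτ1 : τ ≤ 1)
    (hs : s ∈ Set.Icc (0 : ℝ) 1) {ω : ℂ} (hω : ω * star ω = 1) :
    IsQuantumState (preparedState τ s ω) := by
  have hA := ofReal_sqrt_mul_self (sub_nonneg.2 hs.2)
  have hB := ofReal_sqrt_mul_self hs.1
  constructor
  · set A : ℂ := ((Real.sqrt (1 - s) : ℝ) : ℂ) with hAdef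
    set B : ℂ := ((Real.sqrt s : ℝ) : ℂ) with hBdef
    have hAs : (starRingEnd ℂ) A = A := Complex.conj_ofReal _
    have hBs : (starRingEnd ℂ) B = B := Complex.conj_ofReal _
    have heq : preparedState τ s ω =
        ((1 - τ : ℝ) : ℂ) • Matrix.vecMulVec ![A, B * star ω] (star ![A, B * star ω]) +
        (τ : ℂ) • Matrix.vecMulVec ![-(B * ω), A] (star ![-(B * ω), A]) := by
      simp only [Complex.star_def] at hω
      push_cast at hA
      ext i j
      rw [Matrix.add_apply, Matrix.smul_apply, Matrix.smul_apply, Matrix.vecMulVec_apply,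
        Matrix.vecMulVec_apply, Pi.star_apply, Pi.star_apply]
      fin_cases i <;> fin_cases j <;> simp [preparedState, ← hAdef, ← hBdef, hAs, hBs]
      · linear_combination (-(1 - (τ : ℂ))) * hA - τ * hB - τ * B * B * hω
      · ring
      · ring
      · linear_combination (-(1 - (τ : ℂ))) * hB - τ * hA - (1 - (τ : ℂ)) * B * B * hω
    rw [heq]
    exact ((Matrix.posSemidef_vecMulVec_self_star _).smul
      (Complex.zero_le_real.2 (sub_nonneg.2 hτ1))).add
      ((Matrix.posSemidef_vecMulVec_self_star _).smul (Complex.zero_le_real.2 hτ0))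
  · simp [preparedState, Matrix.trace_fin_two]
    ring

/-- The entry `(i, j)` of the density matrix of a coherent state, without its phase. -/
def coherentAmplitude (l : ℕ) (s : ℝ) (i j : ℕ) : ℂ :=
  binomRoot l i * binomRoot l j *
    (((Real.sqrt (1 - s) : ℝ) : ℂ) ^ (l - i) * ((Real.sqrt (1 - s) : ℝ) : ℂ) ^ (l - j) *
      (((Real.sqrt s : ℝ) : ℂ) ^ i * ((Real.sqrt s : ℝ) : ℂ) ^ j))

theorem coherentVector_mul_star (l : ℕ) (s : ℝ) (ω : ℂ) (i j : Fin (l + 1)) :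
    coherentVector l s ω i * star (coherentVector l s ω j) =
      coherentAmplitude l s i j * (ω ^ (i : ℕ) * star ω ^ (j : ℕ)) := by
  simp only [coherentVector, coherentAmplitude, star_mul', star_pow, star_binomRoot,
    Complex.star_def, Complex.conj_ofReal]
  ring

theorem coherentAmplitude_comm (l : ℕ) (s : ℝ) (i j : ℕ) :
    coherentAmplitude l s i j = coherentAmplitude l s j i := by
  rw [coherentAmplitude, coherentAmplitude]
  ring

theorem coherentAmplitude_self (l : ℕ) {s : ℝ} (hs : s ∈ Set.Icc (0 : ℝ) 1) (i : ℕ) :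
    coherentAmplitude l s i i = l.choose i * ((s : ℂ) ^ i * (1 - (s : ℂ)) ^ (l - i)) := by
  rw [coherentAmplitude, ← mul_pow, ← mul_pow, ofReal_sqrt_mul_self hs.1,
    ofReal_sqrt_mul_self (sub_nonneg.2 hs.2), binomRoot_mul_self]
  push_cast
  ring

theorem coherentAmplitude_succ_mul {l : ℕ} {s : ℝ} (hs : s ∈ Set.Icc (0 : ℝ) 1) {i : ℕ}
    (hi : i + 1 ≤ l) :
    coherentAmplitude l s i (i + 1) * (Real.sqrt (1 - s) * Real.sqrt s : ℝ) =
      binomRoot l i * binomRoot l (i + 1) *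
        ((s : ℂ) ^ (i + 1) * (1 - (s : ℂ)) ^ (l + 1 - (i + 1))) := by
  have hA := ofReal_sqrt_mul_self (sub_nonneg.2 hs.2)
  have hB := ofReal_sqrt_mul_self hs.1
  push_cast at hA
  rw [Complex.ofReal_mul, coherentAmplitude, ← hA]
  have hB' : (s : ℂ) ^ (i + 1) =
      (((Real.sqrt s : ℝ) : ℂ) * ((Real.sqrt s : ℝ) : ℂ)) ^ (i + 1) := by rw [hB]
  rw [hB', mul_pow, mul_pow, show l + 1 - (i + 1) = l - (i + 1) + 1 by omega,
    show l - i = l - (i + 1) + 1 by omega]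
  ring

theorem isQuantumState_coherent (l : ℕ) {s : ℝ} (hs : s ∈ Set.Icc (0 : ℝ) 1) {ω : ℂ}
    (hω : ω * star ω = 1) :
    IsQuantumState (Matrix.vecMulVec (coherentVector l s ω) (star (coherentVector l s ω))) := by
  refine ⟨Matrix.posSemidef_vecMulVec_self_star _, ?_⟩
  have h1 : ∀ i : Fin (l + 1), coherentVector l s ω i * star (coherentVector l s ω i) =
      ((l.choose i * (s ^ (i : ℕ) * (1 - s) ^ (l - (i : ℕ))) : ℝ) : ℂ) := by
    intro i
    rw [coherentVector_mul_star, ← mul_pow, hω, one_pow, mul_one, coherentAmplitude_self l hs]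
    push_cast
    rfl
  simp only [Matrix.trace, Matrix.diag_apply, Matrix.vecMulVec_apply, Pi.star_apply, h1]
  rw [← Complex.ofReal_sum, Fin.sum_univ_eq_sum_range
    fun i => (l.choose i * (s ^ i * (1 - s) ^ (l - i)) : ℝ)]
  have h2 := add_pow s (1 - s) l
  rw [add_sub_cancel, one_pow] at h2
  refine (congrArg _ (Eq.trans (Finset.sum_congr rfl fun i _ => ?_) h2.symm)).trans
    Complex.ofReal_one
  ring

section PhaseAverage

variable {ι : Type*} [Fintype ι] {l : ℕ} {w s : ι → ℝ}

theorem sum_coherentAmplitude_self_mul (hs : ∀ k, s k ∈ Set.Icc (0 : ℝ) 1)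
    (hquad : ∀ j ≤ l + 1, ∑ k, (w k : ℂ) * ((s k : ℂ) ^ j * (1 - (s k : ℂ)) ^ (l + 1 - j)) =
      1 / (((l : ℂ) + 2) * ((l + 1).choose j : ℂ)))
    {n : ℕ} (hn : n ≤ l) (x y : ℂ) :
    ∑ k, (w k : ℂ) * (coherentAmplitude l (s k) n n * (x * (1 - (s k : ℂ)) + y * s k)) =
      (x * (l + 1 - n) + y * (n + 1)) / ((l + 1) * (l + 2)) := by
  have hterm : ∀ k, (w k : ℂ) *
      (coherentAmplitude l (s k) n n * (x * (1 - (s k : ℂ)) + y * s k)) =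
      (l.choose n * x) * ((w k : ℂ) * ((s k : ℂ) ^ n * (1 - (s k : ℂ)) ^ (l + 1 - n))) +
      (l.choose n * y) *
        ((w k : ℂ) * ((s k : ℂ) ^ (n + 1) * (1 - (s k : ℂ)) ^ (l + 1 - (n + 1)))) := by
    intro k
    rw [coherentAmplitude_self l (hs k),
      show l + 1 - n = l - n + 1 by omega, show l + 1 - (n + 1) = l - n by omega]
    ring
  have hl1 : (l : ℂ) + 1 ≠ 0 := by exact_mod_cast l.succ_ne_zero
  have hl2 : (l : ℂ) + 2 ≠ 0 := by exact_mod_cast (by omega : l + 2 ≠ 0)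
  have h3 := natCast_choose_ne_zero (n := l + 1) (j := n) (by omega)
  have h4 := natCast_choose_ne_zero (n := l + 1) (j := n + 1) (by omega)
  have h5 : (l.choose n : ℂ) / ((l + 1).choose n : ℂ) = (l + 1 - n) / (l + 1) := by
    rw [div_eq_div_iff h3 hl1]
    linear_combination succ_mul_choose_left (n := l) (e := n) (by omega)
  have h6 : (l.choose n : ℂ) / ((l + 1).choose (n + 1) : ℂ) = (n + 1) / (l + 1) := by
    rw [div_eq_div_iff h4 hl1]
    linear_combination succ_mul_choose_right l n
  simp only [hterm]
  rw [Finset.sum_add_distrib, ← Finset.mul_sum, ← Finset.mul_sum, hquad n (by omega),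
    hquad (n + 1) (by omega)]
  calc _ = (x * ((l.choose n : ℂ) / ((l + 1).choose n : ℂ)) +
        y * ((l.choose n : ℂ) / ((l + 1).choose (n + 1) : ℂ))) / (l + 2) := by field_simp
    _ = _ := by rw [h5, h6]; field_simp

theorem sum_coherentAmplitude_succ_mul (hs : ∀ k, s k ∈ Set.Icc (0 : ℝ) 1)
    (hquad : ∀ j ≤ l + 1, ∑ k, (w k : ℂ) * ((s k : ℂ) ^ j * (1 - (s k : ℂ)) ^ (l + 1 - j)) =
      1 / (((l : ℂ) + 2) * ((l + 1).choose j : ℂ)))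
    {n : ℕ} (hn : n + 1 ≤ l) (τ : ℝ) :
    ∑ k, (w k : ℂ) * (coherentAmplitude l (s k) n (n + 1) *
      (((1 - 2 * τ) * (Real.sqrt (1 - s k) * Real.sqrt (s k)) : ℝ) : ℂ)) =
      (1 - 2 * (τ : ℂ)) / ((l + 1) * (l + 2)) *
        (binomRoot l n * binomRoot l (n + 1) * (n + 1) / l.choose n) := by
  have hterm : ∀ k, (w k : ℂ) * (coherentAmplitude l (s k) n (n + 1) *
      (((1 - 2 * τ) * (Real.sqrt (1 - s k) * Real.sqrt (s k)) : ℝ) : ℂ)) =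
      (binomRoot l n * binomRoot l (n + 1) * (1 - 2 * (τ : ℂ))) *
        ((w k : ℂ) * ((s k : ℂ) ^ (n + 1) * (1 - (s k : ℂ)) ^ (l + 1 - (n + 1)))) := by
    intro k
    rw [Complex.ofReal_mul (1 - 2 * τ), Complex.ofReal_sub, Complex.ofReal_mul, Complex.ofReal_one,
      Complex.ofReal_ofNat]
    linear_combination (w k : ℂ) * (1 - 2 * (τ : ℂ)) * coherentAmplitude_succ_mul (hs k) hn
  have hl1 : (l : ℂ) + 1 ≠ 0 := by exact_mod_cast l.succ_ne_zero
  have hl2 : (l : ℂ) + 2 ≠ 0 := by exact_mod_cast (by omega : l + 2 ≠ 0)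
  have h3 := natCast_choose_ne_zero (n := l) (j := n) (by omega)
  have h4 := natCast_choose_ne_zero (n := l + 1) (j := n + 1) (by omega)
  simp only [hterm]
  rw [← Finset.mul_sum, hquad (n + 1) (by omega)]
  field_simp
  linear_combination (binomRoot l n * binomRoot l (n + 1) * (1 - 2 * (τ : ℂ))) *
    succ_mul_choose_right l n

/-- Averaging over the phases `ω = ζ ^ m` kills the terms with a factor `ω ^ a * star ω ^ b`,
`a ≠ b`. -/
theorem sum_phase_average {N : ℕ} {ζ : ℂ} (hζ : IsPrimitiveRoot ζ N) {a b : ℕ} (ha : a < N)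
    (hb : b < N) {F : ι → ℂ} {c : ℂ} (hc : a = b → ∑ k, (w k : ℂ) * F k = c) :
    ∑ k : ι × Fin N, ((w k.1 / N : ℝ) : ℂ) *
      (F k.1 * ((ζ ^ (k.2 : ℕ)) ^ a * star (ζ ^ (k.2 : ℕ)) ^ b)) = if a = b then c else 0 := by
  have hN : (N : ℂ) ≠ 0 := by exact_mod_cast (by omega : N ≠ 0)
  have hphase : ∀ k : ι, ∑ m : Fin N, ((w k / N : ℝ) : ℂ) *
      (F k * ((ζ ^ (m : ℕ)) ^ a * star (ζ ^ (m : ℕ)) ^ b)) =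
      (w k : ℂ) * F k * (if a = b then 1 else 0) := by
    intro k
    simp only [← mul_assoc (((w k / N : ℝ) : ℂ)), ← Finset.mul_sum]
    rw [hζ.sum_pow_mul_star_pow ha hb, Complex.ofReal_div, Complex.ofReal_natCast]
    split_ifs
    · field_simp
    · simp
  rw [Fintype.sum_prod_type]
  simp only [hphase, ← Finset.sum_mul]
  split_ifs with hab
  · rw [hc hab, mul_one]
  · rw [mul_zero]

/-- The Choi matrix, up to normalization, of the covariant channel that measures in coherent
states `ψ^l` and prepares `preparedState τ`. The average over the phases selects the entries that
conserve the weight, and the average over the nodes turns them into Beta integrals. -/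
theorem covariantMatrix_eq_sum_coherent (hs : ∀ k, s k ∈ Set.Icc (0 : ℝ) 1)
    (hquad : ∀ j ≤ l + 1, ∑ k, (w k : ℂ) * ((s k : ℂ) ^ j * (1 - (s k : ℂ)) ^ (l + 1 - j)) =
      1 / (((l : ℂ) + 2) * ((l + 1).choose j : ℂ)))
    {ζ : ℂ} (hζ : IsPrimitiveRoot ζ (l + 2)) (τ : ℝ) :
    covariantMatrix l ((1 - τ) / (l + 1) ^ 2 : ℝ)
      (((1 - τ) / (l + 1) + τ) / ((l + 1) * (l + 2)) : ℝ) =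
    ∑ k : ι × Fin (l + 2), ((w k.1 / (l + 2 : ℕ) : ℝ) : ℂ) •
      (Matrix.vecMulVec (coherentVector l (s k.1) (ζ ^ (k.2 : ℕ)))
        (star (coherentVector l (s k.1) (ζ ^ (k.2 : ℕ)))) ⊗ₖ
          preparedState τ (s k.1) (ζ ^ (k.2 : ℕ))) := by
  have hl1 : (l : ℂ) + 1 ≠ 0 := by exact_mod_cast l.succ_ne_zero
  have hl2 : (l : ℂ) + 2 ≠ 0 := by exact_mod_cast (by omega : l + 2 ≠ 0)
  ext ⟨i, b⟩ ⟨j, b'⟩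
  have hi : (i : ℕ) ≤ l := by omega
  have hj : (j : ℕ) ≤ l := by omega
  simp only [Matrix.sum_apply, Matrix.smul_apply, Matrix.kroneckerMap_apply,
    Matrix.vecMulVec_apply, Pi.star_apply, coherentVector_mul_star, smul_eq_mul, covariantMatrix,
    Matrix.of_apply]
  generalize (i : ℕ) = i' at *
  generalize (j : ℕ) = j' at *
  fin_cases b <;> fin_cases b'
  · have h := sum_phase_average (w := w) hζ (a := i') (b := j') (by omega) (by omega)
      (F := fun k => coherentAmplitude l (s k) i' j' * ((1 - τ) * (1 - (s k : ℂ)) + τ * s k))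
      (c := ((1 - τ) * (l + 1 - i') + τ * (i' + 1)) / ((l + 1) * (l + 2)))
      (by rintro rfl; exact sum_coherentAmplitude_self_mul hs hquad hi _ _)
    refine Eq.trans ?_ (h.symm.trans (Finset.sum_congr rfl fun k _ => ?_))
    · simp only [covariantEntry]
      simp
      split_ifs
      · field_simp
        ring
      · rfl
    · refine congrArg _ ?_
      simp [preparedState]
      ring
  · have h := sum_phase_average (w := w) hζ (a := i' + 1) (b := j') (by omega) (by omega)
      (F := fun k => coherentAmplitude l (s k) i' j' *
        (((1 - 2 * τ) * (Real.sqrt (1 - s k) * Real.sqrt (s k)) : ℝ) : ℂ))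
      (c := (1 - 2 * (τ : ℂ)) / ((l + 1) * (l + 2)) *
        (binomRoot l i' * binomRoot l j' * (i' + 1) / l.choose i'))
      (by rintro rfl; exact sum_coherentAmplitude_succ_mul hs hquad hj _)
    refine Eq.trans ?_ (h.symm.trans (Finset.sum_congr rfl fun k _ => ?_))
    · have := natCast_choose_ne_zero hi
      simp only [covariantEntry]
      simp
      split_ifs
      · field_simp
        ring
      · rfl
    · refine congrArg _ ?_
      simp [preparedState]
      ring
  · have h := sum_phase_average (w := w) hζ (a := i') (b := j' + 1) (by omega) (by omega)
      (F := fun k => coherentAmplitude l (s k) j' i' *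
        (((1 - 2 * τ) * (Real.sqrt (1 - s k) * Real.sqrt (s k)) : ℝ) : ℂ))
      (c := (1 - 2 * (τ : ℂ)) / ((l + 1) * (l + 2)) *
        (binomRoot l j' * binomRoot l i' * (j' + 1) / l.choose j'))
      (by rintro rfl; exact sum_coherentAmplitude_succ_mul hs hquad hi _)
    refine Eq.trans ?_ (h.symm.trans (Finset.sum_congr rfl fun k _ => ?_))
    · have := natCast_choose_ne_zero hj
      simp only [covariantEntry]
      simp
      split_ifs
      · field_simp
        ring
      · rfl
    · simp only [coherentAmplitude_comm l _ j' i']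
      refine congrArg _ ?_
      simp [preparedState]
      ring
  · have h := sum_phase_average (w := w) hζ (a := i') (b := j') (by omega) (by omega)
      (F := fun k => coherentAmplitude l (s k) i' j' * (τ * (1 - (s k : ℂ)) + (1 - τ) * s k))
      (c := (τ * (l + 1 - i') + (1 - τ) * (i' + 1)) / ((l + 1) * (l + 2)))
      (by rintro rfl; exact sum_coherentAmplitude_self_mul hs hquad hi _ _)
    refine Eq.trans ?_ (h.symm.trans (Finset.sum_congr rfl fun k _ => ?_))
    · simp only [covariantEntry]
      simp
      split_ifs
      · field_simp
        ring
      · rfl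
    · refine congrArg _ ?_
      simp [preparedState]
      ring

end PhaseAverage

/-- The parameter `τ = 0` gives the least `p` for which `Ψ_p` is entanglement-breaking, and `τ = 1`
gives `p = 1`. -/
theorem isSeparableState_covariantMatrix (l : ℕ) {τ : ℝ} (hτ0 : 0 ≤ τ) (hτ1 : τ ≤ 1) :
    IsSeparableState (covariantMatrix l ((1 - τ) / (l + 1) ^ 2 : ℝ)
      (((1 - τ) / (l + 1) + τ) / ((l + 1) * (l + 2)) : ℝ)) := by
  obtain ⟨ι, _, w, s, hw, hw1, hs, hquad⟩ := exists_quadrature (l + 1)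
  obtain ⟨ζ, hζ⟩ : ∃ ζ : ℂ, IsPrimitiveRoot ζ (l + 2) :=
    ⟨_, Complex.isPrimitiveRoot_exp _ (by omega)⟩
  have hunit : ∀ m : ℕ, ζ ^ m * star (ζ ^ m) = 1 := by
    intro m
    rw [star_pow, ← mul_pow, hζ.mul_star_self (by omega), one_pow]
  have hquadC : ∀ j ≤ l + 1, ∑ k, (w k : ℂ) * ((s k : ℂ) ^ j * (1 - (s k : ℂ)) ^ (l + 1 - j)) =
      1 / (((l : ℂ) + 2) * ((l + 1).choose j : ℂ)) := by
    intro j hj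
    have := congrArg (fun r : ℝ => (r : ℂ)) (hquad j hj)
    push_cast at this
    rw [this]
    ring
  refine isSeparableState_of_fintype (ι := ι × Fin (l + 2)) (q := fun k => w k.1 / (l + 2 : ℕ))
    (ρ := fun k => Matrix.vecMulVec (coherentVector l (s k.1) (ζ ^ (k.2 : ℕ)))
      (star (coherentVector l (s k.1) (ζ ^ (k.2 : ℕ)))))
    (σ := fun k => preparedState τ (s k.1) (ζ ^ (k.2 : ℕ)))
    (fun k => div_nonneg (hw k.1) (Nat.cast_nonneg _)) ?_
    (fun k => isQuantumState_coherent l (hs k.1) (hunit k.2))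
    (fun k => isQuantumState_preparedState hτ0 hτ1 (hs k.1) (hunit k.2))
    (covariantMatrix_eq_sum_coherent hs hquadC hζ τ)
  have hN : ((l + 2 : ℕ) : ℝ) ≠ 0 := by positivity
  rw [Fintype.sum_prod_type]
  simp only [Finset.sum_const, Finset.card_univ, Fintype.card_fin, nsmul_eq_mul,
    mul_div_cancel₀ _ hN, hw1]

theorem choiMatrix_mixture (n : ℕ) (p : ℂ) :
    choiMatrix ((1 - p) • stinespringMap (polarization n) +
      p • stinespringMap (wedgeEmbedding (n + 1))) =
    covariantMatrix (n + 1) ((1 - p) / (n + 1)) (p / (n + 3)) := by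
  rw [choiMatrix_add_smul, choiMatrix_polarization, choiMatrix_wedgeEmbedding,
    covariantMatrix_linear]
  congr 1
  · ring
  · push_cast
    ring

end

theorem theorem3p2 (l : ℕ) (hl : 1 ≤ l) (p : ℝ) (hp0 : 0 ≤ p) (hp1 : p ≤ 1) :
    -- the Clebsch-Gordan isometries from `H_l` to `H_1 ⊗ H_(l-1)` and `H_1 ⊗ H_(l+1)` exist
    (∃ α, IsClebschGordanIsometry 1 (l - 1) l α) ∧
    (∃ β, IsClebschGordanIsometry 1 (l + 1) l β) ∧
    -- and, whichever are taken, the channel `(1-p) Φ_(l-1) + p Φ_(l+1)` is PPT, resp. EBT, as claimed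
    ∀ α β, IsClebschGordanIsometry 1 (l - 1) l α → IsClebschGordanIsometry 1 (l + 1) l β →
      ∀ Ψ : Matrix (Fin (l + 1)) (Fin (l + 1)) ℂ →ₗ[ℂ] Matrix (Fin 2) (Fin 2) ℂ,
        Ψ = (1 - (p : ℂ)) • stinespringMap α + (p : ℂ) • stinespringMap β →
        (IsPPT Ψ ↔ 1 / ((l : ℝ) + 1) ≤ p ∧ p ≤ 1) ∧
        (1 / ((l : ℝ) + 1) ≤ p ∧ p ≤ 1 ↔ IsEBT Ψ) := by
  obtain ⟨n, rfl⟩ : ∃ n, l = n + 1 := ⟨l - 1, by omega⟩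
  refine ⟨⟨_, isClebschGordanIsometry_polarization n⟩,
    ⟨_, isClebschGordanIsometry_wedgeEmbedding (n + 1)⟩, fun α β hα hβ Ψ hΨ => ?_⟩
  have hchoi : choiMatrix Ψ =
      covariantMatrix (n + 1) ((1 - p) / (n + 1) : ℝ) (p / (n + 3) : ℝ) := by
    rw [hΨ, IsClebschGordanIsometry.stinespringMap_eq_polarization (n := n) hα,
      hβ.stinespringMap_eq_wedgeEmbedding]
    refine (choiMatrix_mixture n p).trans ?_
    push_cast
    rfl
  have hn1 : (0 : ℝ) < n + 1 := by positivity
  have hn2 : (0 : ℝ) < n + 2 := by positivity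
  have hn3 : (0 : ℝ) < n + 3 := by positivity
  have hppt : IsPPT Ψ → 1 / (((n + 1 : ℕ) : ℝ) + 1) ≤ p ∧ p ≤ 1 := by
    intro h
    rw [IsPPT, hchoi] at h
    have hle := le_of_posSemidef_partialTranspose hl h
    refine ⟨?_, hp1⟩
    push_cast at hle ⊢
    rw [show (n : ℝ) + 1 + 2 = n + 3 by ring, mul_div_cancel₀ _ hn3.ne', div_le_iff₀ hn1] at hle
    rw [div_le_iff₀ (by positivity)]
    linarith
  have hebt : 1 / (((n + 1 : ℕ) : ℝ) + 1) ≤ p ∧ p ≤ 1 → IsEBT Ψ := by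
    rintro ⟨h, -⟩
    push_cast at h
    rw [div_le_iff₀ (by positivity)] at h
    -- `τ` interpolates linearly between `τ = 0` at `p = 1 / (l + 1)` and `τ = 1` at `p = 1`
    have hsep := isSeparableState_covariantMatrix (n + 1) (τ := ((n + 2) * p - 1) / (n + 1))
      (div_nonneg (by linarith) hn1.le) ((div_le_one hn1).2 (by nlinarith))
    rw [IsEBT, hchoi, smul_covariantMatrix, Fintype.card_fin]
    convert hsep using 2
    · push_cast
      have h1 : (n : ℂ) + 1 ≠ 0 := by exact_mod_cast hn1.ne'
      have h2 : (n : ℂ) + 1 + 1 ≠ 0 := by exact_mod_cast (by omega : n + 1 + 1 ≠ 0)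
      field_simp
      ring
    · push_cast
      have h1 : (n : ℂ) + 1 ≠ 0 := by exact_mod_cast hn1.ne'
      have h2 : (n : ℂ) + 1 + 1 ≠ 0 := by exact_mod_cast (by omega : n + 1 + 1 ≠ 0)
      have h3 : (n : ℂ) + 3 ≠ 0 := by exact_mod_cast hn3.ne'
      have h4 : (n : ℂ) + 1 + 2 ≠ 0 := by exact_mod_cast (by omega : n + 1 + 2 ≠ 0)
      field_simp
      ring
  exact ⟨⟨hppt, fun h => (hebt h).isPPT⟩, ⟨hebt, fun h => hppt h.isPPT⟩⟩
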